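/- Let $d>2$, let $A\in\mathbb R^{d\times d}$ be symmetric with smallest eigenvalue $\lambda_{\min}$, let $b\in\mathbb R^d$, $\rho>0$, and let $\beta\ge\|A\|_{\mathrm{op}}$. Let $$f(x)=\tfrac12x^TAx+b^Tx+\tfrac{\rho}{3}\|x\|^3$$ and let $s$ be a global minimizer of $f$ on $\mathbb R^d$. For a vector $c\in\mathbb R^d$ put $$R_\rho(c)=\frac{\beta}{2\rho}+\sqrt{\Big(\frac{\beta}{2\rho}\Big)^2+\frac{\|c\|}{\rho}},\qquad R_{\mathrm c}(c)=-\frac{c^TAc}{2\rho\|c\|^2}+\sqrt{\Big(\frac{c^TAc}{2\rho\|c\|^2}\Big)^2+\frac{\|c\|}{\rho}}.$$ Let $0<\varepsilon\le(\tfrac12\beta+\rho\|s\|)\|s\|^2$, $\delta>0$, $0<\bar\sigma\le1$, let $u$ be a random vector distributed uniformly on the unit sphere of $\mathbb R^d$, and let $$\tilde b=b+\sigma u,\qquad \sigma=\frac{\rho\varepsilon}{\beta+2\rho\|s\|}\cdot\frac{\bar\sigma}{12}.$$ Then with probability at least $1-\delta$ the following holds. Let $\eta>0$ be any step size with $\eta\le\frac{1}{4(\beta+\rho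 R_\rho(b))}$ or $\eta\le\frac{1}{4(\beta+\rho R_\rho(\tilde b))}$, let $\tilde x_0=-r\,\tilde b/\|\tilde b\|$ with any $r\in[0,R_{\mathrm c}(\tilde b)]$, and let $\tilde x_{t+1}=\tilde x_t-\eta\nabla\tilde f(\tilde x_t)$ be the gradient descent iterates for $\tilde f(x)=\tfrac12x^TAx+\tilde b^Tx+\tfrac{\rho}{3}\|x\|^3$. Then $$f(\tilde x_t)\le f(s)+(1+\bar\sigma)\varepsilon$$ for every integer $t\ge0$ with $$t\ge\frac{6\,\tilde\tau_{\mathrm{grow}}+14\,\tilde\tau_{\mathrm{converge}}}{(1+\bar\sigma)^{-1}\eta}\,\min\Big\{\frac{1}{\lambda_{\min}+\rho\|s\|},\frac{10\|s\|^2}{\varepsilon}\Big\},$$ where $\tilde\tau_{\mathrm{grow}}=\log\Big(1+\frac{3\cdot\mathbf 1_{\{\lambda_{\min}<0\}}\sqrt d}{\bar\sigma\delta}\Big)$, $\tilde\tau_{\mathrm{converge}}=\log\frac{(\beta+2\rho\|s\|)\|s\|^2}{\varepsilon}$, and $1/0=+\infty$. (Nothing is assumed about the component of $b$ along the eigenvectors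 for $\lambda_{\min}$.) -/

import Mathlib

open MeasureTheory ProbabilityTheory

namespace CubicGD

noncomputable section

/-- The action `x ↦ A x` of a matrix on Euclidean space, as a continuous linear map.  Its norm is
the `ℓ²`-operator norm of `A`. -/
abbrev opOf {d : ℕ} (A : Matrix (Fin d) (Fin d) ℝ) :
    EuclideanSpace ℝ (Fin d) →L[ℝ] EuclideanSpace ℝ (Fin d) :=
  Matrix.toEuclideanCLM (𝕜 := ℝ) A

/-- The cubic-regularized quadratic `f(x) = ½ xᵀ A x + bᵀ x + (ρ/3) ‖x‖³`. -/
def cubic {d : ℕ} (A : Matrix (Fin d) (Fin d) ℝ) (b : EuclideanSpace ℝ (Fin d)) (ρ : ℝ)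
    (x : EuclideanSpace ℝ (Fin d)) : ℝ :=
  1 / 2 * inner ℝ x (opOf A x) + inner ℝ b x + ρ / 3 * ‖x‖ ^ 3

/-- The smallest eigenvalue of `A` (the real spectrum of a symmetric matrix of positive size is a
finite nonempty set). -/
def lamMin {d : ℕ} (A : Matrix (Fin d) (Fin d) ℝ) : ℝ := sInf (spectrum ℝ A)

/-- The upper bound `R_ρ = β/(2ρ) + √((β/(2ρ))² + ‖b‖/ρ)` on the norm of a minimizer. -/
def upperRadius {d : ℕ} (β ρ : ℝ) (b : EuclideanSpace ℝ (Fin d)) : ℝ :=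
  β / (2 * ρ) + √((β / (2 * ρ)) ^ 2 + ‖b‖ / ρ)

/-- The Cauchy radius `R_c = -bᵀAb/(2ρ‖b‖²) + √((bᵀAb/(2ρ‖b‖²))² + ‖b‖/ρ)`. -/
def cauchyRadius {d : ℕ} (A : Matrix (Fin d) (Fin d) ℝ) (ρ : ℝ)
    (b : EuclideanSpace ℝ (Fin d)) : ℝ :=
  -inner ℝ b (opOf A b) / (2 * ρ * ‖b‖ ^ 2) +
    √((inner ℝ b (opOf A b) / (2 * ρ * ‖b‖ ^ 2)) ^ 2 + ‖b‖ / ρ)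

/-- The step-size assumption `0 < η ≤ 1 / (4 (β + ρ R_ρ))` for the problem with linear
term `b`. -/
def StepSize {d : ℕ} (β ρ : ℝ) (b : EuclideanSpace ℝ (Fin d)) (η : ℝ) : Prop :=
  0 < η ∧ η ≤ 1 / (4 * (β + ρ * upperRadius β ρ b))

/-- The initialization assumption `x₀ = -r b / ‖b‖` with `r ∈ [0, R_c]`, for the problem with
linear term `b`. -/
def Initialization {d : ℕ} (A : Matrix (Fin d) (Fin d) ℝ) (ρ : ℝ)
    (b x₀ : EuclideanSpace ℝ (Fin d)) : Prop :=
  ∃ r : ℝ, 0 ≤ r ∧ r ≤ cauchyRadius A ρ b ∧ x₀ = -((r / ‖b‖) • b)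

/-- The gradient descent iterates `x_{t+1} = x_t - η ∇f(x_t)` on the cubic problem with data
`A`, `b`, `ρ`, started at `x₀`. -/
def gdIter {d : ℕ} (A : Matrix (Fin d) (Fin d) ℝ) (b : EuclideanSpace ℝ (Fin d)) (ρ η : ℝ)
    (x₀ : EuclideanSpace ℝ (Fin d)) : ℕ → EuclideanSpace ℝ (Fin d)
  | 0 => x₀
  | t + 1 => gdIter A b ρ η x₀ t - η • gradient (cubic A b ρ) (gdIter A b ρ η x₀ t)

/-- The uniform distribution on the unit sphere of `ℝᵈ`: normalized surface measure. -/
def uniformSphere (d : ℕ) : Measure (Metric.sphere (0 : EuclideanSpace ℝ (Fin d)) 1) :=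
  ((volume : Measure (EuclideanSpace ℝ (Fin d))).toSphere Set.univ)⁻¹ •
    (volume : Measure (EuclideanSpace ℝ (Fin d))).toSphere

/-- The perturbation size `σ = (ρ ε / (β + 2 ρ ‖s‖)) · σ̄ / 12`, with `n = ‖s‖`. -/
def pertSize (β ρ ε σbar n : ℝ) : ℝ := ρ * ε / (β + 2 * ρ * n) * (σbar / 12)

/-- `log (1 + 3 · 1_{λ_min < 0} · √d / (σ̄ δ))`. -/
def tauGrow (d : ℕ) (lam δ σbar : ℝ) : ℝ :=
  Real.log (1 + 3 * (if lam < 0 then 1 else 0) * √(d : ℝ) / (σbar * δ))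

/-- `log ((β + 2 ρ ‖s‖) ‖s‖² / ε)`, with `n = ‖s‖`. -/
def tauConverge (β ρ ε n : ℝ) : ℝ := Real.log ((β + 2 * ρ * n) * n ^ 2 / ε)

/-- `min {1 / μ, q}` for `μ ≥ 0`, where `1 / 0 = +∞`, so that the value is `q` if `μ = 0`. -/
def minInv (μ q : ℝ) : ℝ := if μ = 0 then q else min (1 / μ) q

/-- The number of iterations
`(6 τ_grow + 14 τ_converge) / ((1 + σ̄)⁻¹ η) · min {1 / (λ_min + ρ ‖s‖), 10 ‖s‖² / ε}`,
with `lam = λ_min` and `n = ‖s‖`. -/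
def iterBound (d : ℕ) (lam β ρ ε δ σbar η n : ℝ) : ℝ :=
  (6 * tauGrow d lam δ σbar + 14 * tauConverge β ρ ε n) / ((1 + σbar)⁻¹ * η) *
    minInv (lam + ρ * n) (10 * n ^ 2 / ε)

end

end CubicGD

namespace CubicGD

/-! ### Gradient, exact expansion at a stationary point, second-order condition, eigenbasis. -/

section Calculus

variable {d : ℕ} {A : Matrix (Fin d) (Fin d) ℝ} {b s : EuclideanSpace ℝ (Fin d)} {ρ : ℝ}

/-! The run on the perturbed problem, with linear term `c`, is compared directly with the minimizer
`s` of the original problem; no minimizer of the perturbed problem is needed.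

In an eigenbasis of `A` the iterates are `-w_i c_i`, with nonnegative weights obeying a scalar
recursion coupled only through the norm. This gives nondecreasing norms
(`norm_monotone_of_weights`). A monotone norm cannot overshoot `‖s‖` by much, since the excess over
`s` would then shrink by a fixed amount forever (`norm_le_of_perturbed_recursion`).

Let `1 / m` be the minimum in the iteration bound. While `ρ‖x‖ ≤ -λ_min - m/3`, the coordinate of
`x` along the lowest eigenvector grows geometrically at rate `1 + ηm/3`. As it is bounded by the
norm, this phase has logarithmic length, provided that `c` is not too small along that eigenvector
(`growth_time`). By monotonicity the phase never returns. Afterwards, as long as the original gap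
exceeds `ε`, the gradient is aligned with `x - s` (`alignment_ge`), and the potential `‖x - s‖² +
(15/11) η (f̃(x) - f̃(s))` contracts by `1 - ηm/3` per step (`gap_decay`). Adding the two durations
gives `cubic_le`.

Randomness enters only through the component of `c` along one eigenvector. A coordinate of a uniform
point on the sphere has density at most `√d / 2` (`uniformSphere_slab_le`), so outside an event of
probability at most `δ` that component is at least `σδ/√d` in absolute value. -/

lemma opOf_isSymmetric (hA : A.IsSymm) (x y : EuclideanSpace ℝ (Fin d)) :
    inner ℝ (opOf A x) y = inner ℝ x (opOf A y) := by
  have hH : A.IsHermitian := by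
    rw [Matrix.IsHermitian, Matrix.conjTranspose_eq_transpose_of_trivial]; exact hA
  exact (Matrix.isSymmetric_toEuclideanLin_iff.2 hH) x y

lemma hasGradientAt_cubic (hA : A.IsSymm) (b : EuclideanSpace ℝ (Fin d)) (ρ : ℝ)
    (x : EuclideanSpace ℝ (Fin d)) :
    HasGradientAt (cubic A b ρ) (opOf A x + b + (ρ * ‖x‖) • x) x := by
  rw [hasGradientAt_iff_hasFDerivAt]
  have h1 : HasFDerivAt (fun x : EuclideanSpace ℝ (Fin d) => inner ℝ x (opOf A x)) _ x :=
    (hasFDerivAt_id x).inner ℝ (opOf A).hasFDerivAt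
  have h2 : HasFDerivAt (fun x : EuclideanSpace ℝ (Fin d) => inner ℝ b x) (innerSL ℝ b) x :=
    (innerSL ℝ b).hasFDerivAt
  have h3 := hasFDerivAt_norm_rpow x (p := 3) (by norm_num)
  have h3' : HasFDerivAt (fun x : EuclideanSpace ℝ (Fin d) => ‖x‖ ^ 3)
      ((3 * ‖x‖) • innerSL ℝ x) x := by
    simpa [show (3 : ℝ) - 2 = 1 by norm_num] using h3
  have h := ((h1.const_mul (1 / 2)).add h2).add (h3'.const_mul (ρ / 3))
  refine h.congr_fderiv ?_
  ext y
  simp only [InnerProductSpace.toDual_apply_apply, inner_add_left, inner_smul_left,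
    add_apply, smul_apply, smul_eq_mul,
    ContinuousLinearMap.comp_apply, ContinuousLinearMap.prod_apply, fderivInnerCLM_apply,
    ContinuousLinearMap.id_apply, innerSL_apply_apply, id, RCLike.conj_to_real]
  rw [real_inner_comm (opOf A x) y, opOf_isSymmetric hA]
  ring

lemma gdIter_succ (hA : A.IsSymm) (b : EuclideanSpace ℝ (Fin d)) (ρ η : ℝ)
    (x₀ : EuclideanSpace ℝ (Fin d)) (t : ℕ) :
    gdIter A b ρ η x₀ (t + 1) = gdIter A b ρ η x₀ t -
      η • (opOf A (gdIter A b ρ η x₀ t) + b +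
        (ρ * ‖gdIter A b ρ η x₀ t‖) • gdIter A b ρ η x₀ t) := by
  rw [gdIter, (hasGradientAt_cubic hA b ρ _).gradient]

lemma stationary_of_minimizer (hA : A.IsSymm) (hs : ∀ y, cubic A b ρ s ≤ cubic A b ρ y) :
    opOf A s + b + (ρ * ‖s‖) • s = 0 := by
  have h := hasGradientAt_cubic hA b ρ s
  have hmin : IsLocalMin (cubic A b ρ) s := Filter.Eventually.of_forall hs
  have := hmin.hasFDerivAt_eq_zero (hasGradientAt_iff_hasFDerivAt.1 h)
  exact (InnerProductSpace.toDual ℝ _).map_eq_zero_iff.1 this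

/-- Exact expansion of the cubic model around a stationary point. -/
lemma cubic_sub_cubic (hA : A.IsSymm) (hs : opOf A s + b + (ρ * ‖s‖) • s = 0)
    (x : EuclideanSpace ℝ (Fin d)) :
    cubic A b ρ x - cubic A b ρ s =
      1 / 2 * (inner ℝ (x - s) (opOf A (x - s)) + ρ * ‖s‖ * ‖x - s‖ ^ 2) +
        ρ / 6 * (‖s‖ - ‖x‖) ^ 2 * (‖s‖ + 2 * ‖x‖) := by
  have h1 : inner ℝ (opOf A s + b + (ρ * ‖s‖) • s) (x - s) = 0 := by rw [hs, inner_zero_left]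
  have h2 : ‖x - s‖ ^ 2 = ‖x‖ ^ 2 - 2 * inner ℝ x s + ‖s‖ ^ 2 := norm_sub_sq_real x s
  simp only [inner_add_left, inner_smul_left, inner_sub_right, real_inner_self_eq_norm_sq,
    RCLike.conj_to_real] at h1
  rw [h2]
  simp only [cubic, map_sub, inner_sub_left, inner_sub_right]
  have h3 := opOf_isSymmetric hA s x
  have h4 := opOf_isSymmetric hA s s
  have h5 := real_inner_comm x s
  have h6 := real_inner_comm (opOf A s) x
  linear_combination h1 - 1 / 2 * h3 + h4 + 1 / 2 * h6 - ρ * ‖s‖ * h5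

/-- The second-order necessary condition `A + ρ ‖s‖ I ⪰ 0`. -/
lemma curvature_nonneg_of_minimizer (hA : A.IsSymm) (hs : ∀ y, cubic A b ρ s ≤ cubic A b ρ y)
    (hs0 : s ≠ 0) (v : EuclideanSpace ℝ (Fin d)) :
    0 ≤ inner ℝ v (opOf A v) + ρ * ‖s‖ * ‖v‖ ^ 2 := by
  have key : ∀ v : EuclideanSpace ℝ (Fin d), inner ℝ s v ≠ 0 →
      0 ≤ inner ℝ v (opOf A v) + ρ * ‖s‖ * ‖v‖ ^ 2 := by
    intro v hv
    have hv0 : ‖v‖ ≠ 0 := by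
      intro h; rw [norm_eq_zero] at h; exact hv (by simp [h])
    -- This `k` makes `s + k • v` the second intersection of the line with the sphere of radius
    -- `‖s‖`. There the norm term of the expansion vanishes, so minimality leaves only the quadratic
    -- form in `v`.
    set k : ℝ := -2 * inner ℝ s v / ‖v‖ ^ 2 with hk
    have hk0 : k ≠ 0 := by
      rw [hk]; exact div_ne_zero (mul_ne_zero (by norm_num) hv) (pow_ne_zero _ hv0)
    have hn : ‖s + k • v‖ = ‖s‖ := by
      have : ‖s + k • v‖ ^ 2 = ‖s‖ ^ 2 := by
        rw [norm_add_sq_real, inner_smul_right, norm_smul, mul_pow, Real.norm_eq_abs, sq_abs, hk]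
        field_simp
        ring
      exact (sq_eq_sq₀ (norm_nonneg _) (norm_nonneg _)).1 this
    have h := cubic_sub_cubic hA (stationary_of_minimizer hA hs) (s + k • v)
    have h2 := hs (s + k • v)
    rw [hn, add_sub_cancel_left, map_smul, inner_smul_left, inner_smul_right, norm_smul, mul_pow,
      Real.norm_eq_abs, sq_abs, RCLike.conj_to_real] at h
    have h3 : 0 ≤ k ^ 2 * (inner ℝ v (opOf A v) + ρ * ‖s‖ * ‖v‖ ^ 2) := by nlinarith
    exact nonneg_of_mul_nonneg_right h3 (by positivity)
  by_cases hv : inner ℝ s v = 0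
  -- If `v ⟂ s` the line is tangent to the sphere; perturb `v` along `s` and pass to the limit.
  · have hcont : Continuous fun k : ℝ =>
        inner ℝ (v + k • s) (opOf A (v + k • s)) + ρ * ‖s‖ * ‖v + k • s‖ ^ 2 := by fun_prop
    have hlim := (hcont.tendsto 0).mono_left (nhdsWithin_le_nhds (s := {0}ᶜ))
    simp only [zero_smul, add_zero] at hlim
    refine ge_of_tendsto hlim ?_
    filter_upwards [self_mem_nhdsWithin] with k hk
    apply key
    rw [inner_add_right, hv, zero_add, inner_smul_right, real_inner_self_eq_norm_sq]
    exact mul_ne_zero hk (pow_ne_zero _ (norm_ne_zero_iff.2 hs0))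
  · exact key v hv

/-- A symmetric matrix has an orthonormal eigenbasis, in which `lamMin` is the smallest
eigenvalue. -/
lemma exists_eigenbasis (hd : 0 < d) (hA : A.IsSymm) :
    ∃ (e : OrthonormalBasis (Fin d) ℝ (EuclideanSpace ℝ (Fin d))) (lam : Fin d → ℝ) (i₀ : Fin d),
      (∀ i, opOf A (e i) = lam i • e i) ∧ lamMin A = lam i₀ ∧ ∀ i, lam i₀ ≤ lam i := by
  have hH : A.IsHermitian := by
    rw [Matrix.IsHermitian, Matrix.conjTranspose_eq_transpose_of_trivial]; exact hA
  have : Nonempty (Fin d) := ⟨⟨0, hd⟩⟩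
  obtain ⟨i₀, hi₀⟩ := Finite.exists_min hH.eigenvalues
  refine ⟨hH.eigenvectorBasis, hH.eigenvalues, i₀, fun i => ?_, ?_, hi₀⟩
  · ext j
    have := congrFun (hH.mulVec_eigenvectorBasis i) j
    rw [Matrix.ofLp_toEuclideanCLM, this]
    rfl
  · rw [lamMin, hH.spectrum_real_eq_range_eigenvalues]
    exact IsLeast.csInf_eq ⟨⟨i₀, rfl⟩, by rintro _ ⟨i, rfl⟩; exact hi₀ i⟩

end Calculus

/-! ### The triangle inequality for coordinatewise bounds. -/

section Minkowski

variable {ι : Type*} [Fintype ι]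

lemma sqrt_sum_sq_le_add {f g h : ι → ℝ} (hfg : ∀ i, |f i| ≤ g i + h i) :
    √(∑ i, f i ^ 2) ≤ √(∑ i, g i ^ 2) + √(∑ i, h i ^ 2) := by
  have h1 := norm_add_le (WithLp.toLp 2 g : EuclideanSpace ℝ ι) (WithLp.toLp 2 h)
  simp only [EuclideanSpace.norm_eq, PiLp.add_apply, Real.norm_eq_abs, sq_abs] at h1
  refine le_trans (Real.sqrt_le_sqrt (Finset.sum_le_sum fun i _ => ?_)) h1
  rw [← sq_abs]
  exact pow_le_pow_left₀ (abs_nonneg _) (hfg i) 2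

end Minkowski

/-! ### The scalar recursion along the eigenvectors

In an eigenbasis the iterates are `x_i = -w_i c_i`, where the weights `w` satisfy the recursion
below, `N` being the norm of the iterate. -/

section Weights

variable {ι : Type*} {lam : ι → ℝ} {η ρ : ℝ} {N : ℕ → ℝ} {w : ℕ → ι → ℝ}

lemma weight_nonneg (hη : 0 < η)
    (hw : ∀ t i, w (t + 1) i = (1 - η * lam i - η * ρ * N t) * w t i + η)
    (hD : ∀ t i, 11 / 15 ≤ 1 - η * lam i - η * ρ * N t) (h0 : ∀ i, 0 ≤ w 0 i) (t : ℕ) (i : ι) :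
    0 ≤ w t i := by
  induction t with
  | zero => exact h0 i
  | succ t ih =>
    rw [hw]
    have := mul_nonneg (le_trans (by norm_num) (hD t i)) ih
    linarith

lemma weight_succ_pos (hη : 0 < η)
    (hw : ∀ t i, w (t + 1) i = (1 - η * lam i - η * ρ * N t) * w t i + η)
    (hD : ∀ t i, 11 / 15 ≤ 1 - η * lam i - η * ρ * N t) (h0 : ∀ i, 0 ≤ w 0 i) (t : ℕ) (i : ι) :
    0 < w (t + 1) i := by
  rw [hw]
  have := mul_nonneg (le_trans (by norm_num) (hD t i)) (weight_nonneg hη hw hD h0 t i)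
  linarith

/-- Subtracting consecutive recursions cancels the source `η`: increments are damped, with a
correction proportional to the growth of the norm. -/
lemma weight_increment_succ
    (hw : ∀ t i, w (t + 1) i = (1 - η * lam i - η * ρ * N t) * w t i + η) (t : ℕ) (i : ι) :
    w (t + 2) i - w (t + 1) i =
      (1 - η * lam i - η * ρ * N t) * (w (t + 1) i - w t i) -
        η * ρ * (N (t + 1) - N t) * w (t + 1) i := by
  have h1 := hw (t + 1) i
  have h2 := hw t i
  rw [show t + 2 = t + 1 + 1 from rfl, h1]
  linear_combination -h2

/-- Relative increments of the weights are ordered against the eigenvalues, as long as the norm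
grows. -/
lemma weight_increment_order (hη : 0 < η) (hρ : 0 < ρ)
    (hw : ∀ t i, w (t + 1) i = (1 - η * lam i - η * ρ * N t) * w t i + η)
    (hD : ∀ t i, 11 / 15 ≤ 1 - η * lam i - η * ρ * N t) {w0 : ℝ} (hw0 : 0 ≤ w0)
    (h0 : ∀ i, w 0 i = w0) {i j : ι} (hij : lam i ≤ lam j) (t : ℕ)
    (hN : ∀ k < t, N k ≤ N (k + 1)) (hj : 0 ≤ w (t + 1) j - w t j) :
    (w (t + 1) j - w t j) * w (t + 1) i ≤ (w (t + 1) i - w t i) * w (t + 1) j := by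
  have h0' : ∀ i, 0 ≤ w 0 i := fun i => by rw [h0]; exact hw0
  induction t with
  | zero =>
    have hi := hw 0 i
    have hj' := hw 0 j
    rw [h0] at hi hj'
    have h1 : w (0 + 1) j ≤ w (0 + 1) i := by
      rw [hi, hj']
      have : 0 ≤ η * (lam j - lam i) * w0 :=
        mul_nonneg (mul_nonneg hη.le (by linarith)) hw0
      linarith
    rw [h0, h0]
    have := mul_nonneg hw0 (sub_nonneg.2 h1)
    linarith
  | succ t ih =>
    have ei := weight_increment_succ hw t i
    have ej := weight_increment_succ hw t j
    have pi := weight_succ_pos hη hw hD h0' t i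
    have pj := weight_succ_pos hη hw hD h0' t j
    have hk : 0 ≤ η * ρ * (N (t + 1) - N t) :=
      mul_nonneg (mul_nonneg hη.le hρ.le) (sub_nonneg.2 (hN t (by omega)))
    have hj1 : 0 ≤ w (t + 1) j - w t j := by
      have h1 : 0 ≤ (1 - η * lam j - η * ρ * N t) * (w (t + 1) j - w t j) := by
        have := mul_nonneg hk pj.le
        rw [show t + 1 + 1 = t + 2 from rfl] at hj
        linarith
      exact nonneg_of_mul_nonneg_right h1 (lt_of_lt_of_le (by norm_num) (hD t j))
    have h2 := ih (fun k hk => hN k (by omega)) hj1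
    have hi1 : 0 ≤ w (t + 1) i - w t i :=
      nonneg_of_mul_nonneg_left (le_trans (mul_nonneg hj1 pi.le) h2) pj
    have hdj : 0 ≤ 1 - η * lam j - η * ρ * N t := le_trans (by norm_num) (hD t j)
    have h3 := mul_le_mul_of_nonneg_left h2 hdj
    have h4 : 0 ≤ η * (lam j - lam i) * ((w (t + 1) i - w t i) * w (t + 1) j) :=
      mul_nonneg (mul_nonneg hη.le (by linarith)) (mul_nonneg hi1 pj.le)
    have h5 : (w (t + 2) j - w (t + 1) j) * w (t + 1) i ≤
        (w (t + 2) i - w (t + 1) i) * w (t + 1) j := by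
      rw [ei, ej]; nlinarith
    rw [show t + 1 + 1 = t + 2 from rfl]
    nlinarith

/-- Growth of the weight along the eigenvector with the most negative eigenvalue. -/
lemma weight_growth (hη : 0 < η)
    (hw : ∀ t i, w (t + 1) i = (1 - η * lam i - η * ρ * N t) * w t i + η) (h0 : ∀ i, 0 ≤ w 0 i)
    {δ : ℝ} (hδ : 0 < δ) (i : ι) (t : ℕ) (hN : ∀ k < t, ρ * N k ≤ -lam i - δ) :
    (1 + η * δ) ^ t - 1 ≤ δ * w t i ∧ 0 ≤ w t i := by
  induction t with
  | zero => exact ⟨by simpa using mul_nonneg hδ.le (h0 i), h0 i⟩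
  | succ t ih =>
    obtain ⟨h1, h2⟩ := ih fun k hk => hN k (by omega)
    have h3 := hN t (by omega)
    have h4 : (1 + η * δ) * w t i + η ≤ w (t + 1) i := by
      rw [hw]
      have : 0 ≤ η * (-lam i - δ - ρ * N t) * w t i :=
        mul_nonneg (mul_nonneg hη.le (by linarith)) h2
      nlinarith
    have hpos : 0 < 1 + η * δ := by positivity
    refine ⟨?_, le_trans (by positivity) h4⟩
    have h5 := mul_le_mul_of_nonneg_left h1 hpos.le
    have h6 := mul_le_mul_of_nonneg_left h4 hδ.le
    rw [pow_succ]
    linarith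

variable [Fintype ι] {c : ι → ℝ}

/-- The damping factors depend on `i`, so the sign of the sum does not pass through them termwise. A
single threshold `q` works because increments change sign once along the spectrum: positive ones sit
at small eigenvalues, where damping factors are large, and negative ones at large eigenvalues. -/
lemma sum_damped_increment_ge (hη : 0 < η) (hρ : 0 < ρ)
    (hw : ∀ t i, w (t + 1) i = (1 - η * lam i - η * ρ * N t) * w t i + η)
    (hD : ∀ t i, 11 / 15 ≤ 1 - η * lam i - η * ρ * N t) {w0 : ℝ} (hw0 : 0 ≤ w0)
    (h0 : ∀ i, w 0 i = w0) (t : ℕ) (hN : ∀ k < t, N k ≤ N (k + 1))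
    (hS : 0 ≤ ∑ i, c i ^ 2 * (w t i * (w (t + 1) i - w t i))) :
    11 / 15 * ∑ i, c i ^ 2 * (w t i * (w (t + 1) i - w t i)) ≤
      ∑ i, (1 - η * lam i - η * ρ * N t) * (c i ^ 2 * (w t i * (w (t + 1) i - w t i))) := by
  have h0' : ∀ i, 0 ≤ w 0 i := fun i => by rw [h0]; exact hw0
  obtain ⟨q, hq, hq'⟩ : ∃ q : ℝ, 11 / 15 ≤ q ∧ ∀ i,
      q * (w (t + 1) i - w t i) ≤
        (1 - η * lam i - η * ρ * N t) * (w (t + 1) i - w t i) := by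
    classical
    by_cases hne : (Finset.univ.filter fun i => w (t + 1) i - w t i < 0).Nonempty
    · obtain ⟨j, hj, hmin⟩ := Finset.exists_min_image _ lam hne
      simp only [Finset.mem_filter, Finset.mem_univ, true_and] at hj hmin
      -- `j` has the smallest eigenvalue among the coordinates with negative increment.
      refine ⟨1 - η * lam j - η * ρ * N t, hD t j, fun i => ?_⟩
      rcases lt_or_ge (w (t + 1) i - w t i) 0 with hi | hi
      · refine mul_le_mul_of_nonpos_right ?_ hi.le
        have := mul_le_mul_of_nonneg_left (hmin i hi) hη.le
        linarith
      · refine mul_le_mul_of_nonneg_right ?_ hi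
        rcases le_total (lam i) (lam j) with h | h
        · have := mul_le_mul_of_nonneg_left h hη.le
          linarith
        -- Impossible case: a nonnegative increment at `i` would force a nonnegative one at `j`.
        · have h1 := weight_increment_order hη hρ hw hD hw0 h0 h t hN hi
          have pi := weight_succ_pos hη hw hD h0' t i
          have pj := weight_succ_pos hη hw hD h0' t j
          have := mul_neg_of_neg_of_pos hj pi
          have := mul_nonneg hi pj.le
          linarith
    · refine ⟨11 / 15, le_rfl, fun i => mul_le_mul_of_nonneg_right (hD t i) ?_⟩
      by_contra hi
      exact hne ⟨i, by simpa using hi⟩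
  calc _ ≤ q * ∑ i, c i ^ 2 * (w t i * (w (t + 1) i - w t i)) :=
        mul_le_mul_of_nonneg_right hq hS
    _ ≤ _ := by
      rw [Finset.mul_sum]
      refine Finset.sum_le_sum fun i _ => ?_
      have := mul_le_mul_of_nonneg_left (hq' i)
        (mul_nonneg (sq_nonneg (c i)) (weight_nonneg hη hw hD h0' t i))
      linarith

/-- The norms of the iterates are nondecreasing. -/
lemma norm_monotone_of_weights (hη : 0 < η) (hρ : 0 < ρ)
    (hw : ∀ t i, w (t + 1) i = (1 - η * lam i - η * ρ * N t) * w t i + η)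
    (hD : ∀ t i, 11 / 15 ≤ 1 - η * lam i - η * ρ * N t) {w0 : ℝ} (hw0 : 0 ≤ w0)
    (h0 : ∀ i, w 0 i = w0) (hN0 : ∀ t, 0 ≤ N t) (hNs : ∀ t, N t ^ 2 = ∑ i, (w t i * c i) ^ 2)
    (hNb : ∀ t, η * ρ * N t ≤ 4 / 15)
    (hS0 : 0 ≤ ∑ i, c i ^ 2 * (w 0 i * (w 1 i - w 0 i))) : Monotone N := by
  have hstep : ∀ t, N (t + 1) ^ 2 = N t ^ 2 + 2 * (∑ i, c i ^ 2 * (w t i * (w (t + 1) i - w t i)))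
      + ∑ i, c i ^ 2 * (w (t + 1) i - w t i) ^ 2 := by
    intro t
    rw [hNs, hNs, Finset.mul_sum, ← Finset.sum_add_distrib, ← Finset.sum_add_distrib]
    exact Finset.sum_congr rfl fun i _ => by ring
  have hP : ∀ t, 0 ≤ ∑ i, c i ^ 2 * (w (t + 1) i - w t i) ^ 2 := fun t =>
    Finset.sum_nonneg fun i _ => by positivity
  have hmono : ∀ t, 0 ≤ ∑ i, c i ^ 2 * (w t i * (w (t + 1) i - w t i)) → N t ≤ N (t + 1) := by
    intro t ht
    refine (sq_le_sq₀ (hN0 t) (hN0 (t + 1))).1 ?_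
    rw [hstep t]
    linarith [hP t]
  have main : ∀ t, (∀ k < t, N k ≤ N (k + 1)) ∧
      0 ≤ ∑ i, c i ^ 2 * (w t i * (w (t + 1) i - w t i)) := by
    intro t
    induction t with
    | zero => exact ⟨fun k hk => absurd hk (Nat.not_lt_zero k), hS0⟩
    | succ t ih =>
      obtain ⟨hN, hS⟩ := ih
      have hNt := hmono t hS
      refine ⟨fun k hk => ?_, ?_⟩
      · rcases Nat.lt_succ_iff_lt_or_eq.1 hk with h | rfl
        · exact hN k h
        · exact hNt
      have h1 := sum_damped_increment_ge (c := c) hη hρ hw hD hw0 h0 t hN hS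
      have h2 : 11 / 15 * ∑ i, c i ^ 2 * (w (t + 1) i - w t i) ^ 2 ≤
          ∑ i, (1 - η * lam i - η * ρ * N t) * (c i ^ 2 * (w (t + 1) i - w t i) ^ 2) := by
        rw [Finset.mul_sum]
        exact Finset.sum_le_sum fun i _ => mul_le_mul_of_nonneg_right (hD t i) (by positivity)
      have h3 : ∑ i, c i ^ 2 * (w (t + 1) i * (w (t + 1 + 1) i - w (t + 1) i)) =
          ∑ i, (1 - η * lam i - η * ρ * N t) * (c i ^ 2 * (w t i * (w (t + 1) i - w t i))) +
          ∑ i, (1 - η * lam i - η * ρ * N t) * (c i ^ 2 * (w (t + 1) i - w t i) ^ 2) -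
          η * ρ * (N (t + 1) - N t) * N (t + 1) ^ 2 := by
        rw [hNs (t + 1), Finset.mul_sum, ← Finset.sum_add_distrib, ← Finset.sum_sub_distrib]
        refine Finset.sum_congr rfl fun i _ => ?_
        rw [show t + 1 + 1 = t + 2 from rfl, weight_increment_succ hw t i]
        ring
      have h4 : η * ρ * (N (t + 1) - N t) * N (t + 1) ^ 2 ≤
          4 / 15 * (N (t + 1) ^ 2 - N t ^ 2) := by
        have e1 : η * ρ * (N (t + 1) - N t) * N (t + 1) ^ 2 ≤
            η * ρ * N (t + 1) * (N (t + 1) ^ 2 - N t ^ 2) := by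
          have : 0 ≤ η * ρ * N (t + 1) * ((N (t + 1) - N t) * N t) :=
            mul_nonneg (mul_nonneg (mul_nonneg hη.le hρ.le) (hN0 _))
              (mul_nonneg (sub_nonneg.2 hNt) (hN0 _))
          linarith
        refine e1.trans (mul_le_mul_of_nonneg_right (hNb _) ?_)
        rw [hstep t]
        linarith [hP t]
      have h5 := hstep t
      rw [h3]
      -- With `S` the sum at time `t` and `P` the sum of squared increments, the new sum is at least
      -- `11/15 (S + P) - 4/15 (2S + P) = 3/15 S + 7/15 P`.
      linarith [hP t]
  exact monotone_nat_of_le_succ fun t => hmono t (main t).2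

end Weights

/-! ### Monotone norms cannot overshoot the minimizer. -/

section Box

variable {ι : Type*} [Fintype ι]

/-- If the norms of the iterates are nondecreasing, they exceed the norm `r` of the exact minimizer
by at most `q`, where `ρ q²` dominates the perturbation `σ` of the linear term. -/
lemma norm_le_of_perturbed_recursion {η ρ r σ q : ℝ} {μ S err : ι → ℝ} {X : ℕ → ι → ℝ} {N : ℕ → ℝ}
    (hη : 0 < η) (hρ : 0 < ρ) (hq : 0 < q) (hσ : σ < ρ * q ^ 2)
    (hX : ∀ t i, X (t + 1) i =
      (1 - η * μ i - η * (ρ * (N t - r))) * X t i + η * μ i * S i - η * err i)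
    (hc : ∀ t i, 0 ≤ 1 - η * μ i - η * (ρ * (N t - r))) (hμ : ∀ i, 0 ≤ μ i)
    (hN : ∀ t, N t = √(∑ i, X t i ^ 2)) (hr : r = √(∑ i, S i ^ 2))
    (herr : √(∑ i, err i ^ 2) = σ) (hmono : Monotone N) (T : ℕ) : N T ≤ r + q := by
  by_contra! hT
  -- `V k` is the norm of the coordinatewise excess of `|X|` over `|S|`. Overshooting by more than
  -- `q` keeps `V > q` for all later times, while each step lowers it by `η(ρq² - σ) > 0`.
  set V : ℕ → ℝ := fun k => √(∑ i, (max (|X (T + k) i| - |S i|) 0) ^ 2) with hV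
  have hNV : ∀ k, N (T + k) ≤ r + V k := by
    intro k
    have h1 := sqrt_sum_sq_le_add (f := X (T + k)) (g := fun i => |S i|)
      (h := fun i => max (|X (T + k) i| - |S i|) 0)
      (fun i => by linarith [le_max_left (|X (T + k) i| - |S i|) 0])
    simp only [sq_abs] at h1
    rw [hN, hr]
    exact h1
  have hVq : ∀ k, q < V k := fun k => by
    linarith [hNV k, hmono (Nat.le_add_right T k)]
  have hstep : ∀ k, V (k + 1) ≤ V k - η * (ρ * q ^ 2 - σ) := by
    intro k
    have hNk : r + q < N (T + k) := lt_of_lt_of_le hT (hmono (Nat.le_add_right T k))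
    rcases isEmpty_or_nonempty ι with hι | ⟨⟨i₀⟩⟩
    · have := hVq k
      simp [hV] at this
      linarith
    set a := 1 - η * (ρ * q) with ha
    have hca : ∀ i, 1 - η * μ i - η * (ρ * (N (T + k) - r)) ≤ a := by
      intro i
      have h1 := mul_nonneg hη.le (hμ i)
      have h2 : η * (ρ * q) ≤ η * (ρ * (N (T + k) - r)) := by
        gcongr; linarith
      rw [ha]; linarith
    have ha0 : 0 ≤ a := (hc (T + k) i₀).trans (hca i₀)
    have h1 := sqrt_sum_sq_le_add (f := fun i => max (|X (T + (k + 1)) i| - |S i|) 0)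
      (g := fun i => a * max (|X (T + k) i| - |S i|) 0) (h := fun i => η * |err i|) ?_
    · have e1 : √(∑ i, (a * max (|X (T + k) i| - |S i|) 0) ^ 2) = a * V k := by
        simp only [mul_pow, ← Finset.mul_sum, hV]
        rw [Real.sqrt_mul (sq_nonneg a), Real.sqrt_sq ha0]
      have e2 : √(∑ i, (η * |err i|) ^ 2) = η * σ := by
        simp only [mul_pow, ← Finset.mul_sum, sq_abs]
        rw [Real.sqrt_mul (sq_nonneg η), Real.sqrt_sq hη.le, herr]
      rw [e1, e2] at h1
      refine h1.trans ?_
      have := mul_le_mul_of_nonneg_left (hVq k).le (by positivity : 0 ≤ η * (ρ * q))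
      rw [ha]; nlinarith
    · intro i
      have hn : 0 ≤ a * max (|X (T + k) i| - |S i|) 0 + η * |err i| :=
        add_nonneg (mul_nonneg ha0 (le_max_right _ _)) (mul_nonneg hη.le (abs_nonneg _))
      rw [abs_of_nonneg (le_max_right _ _)]
      refine max_le ?_ hn
      set cc := 1 - η * μ i - η * (ρ * (N (T + k) - r)) with hcc
      have hc0 : 0 ≤ cc := hc (T + k) i
      have t1 : |X (T + (k + 1)) i| ≤ cc * |X (T + k) i| + η * μ i * |S i| + η * |err i| := by
        rw [← add_assoc, hX]
        calc _ ≤ |cc * X (T + k) i| + |η * μ i * S i| + |η * err i| :=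
              (abs_sub _ _).trans (add_le_add_left (abs_add_le _ _) _)
          _ = _ := by
            rw [abs_mul, abs_mul (η * μ i), abs_mul η, abs_mul η, abs_of_nonneg hc0, abs_of_pos hη,
              abs_of_nonneg (hμ i)]
      have t2 : cc * (|X (T + k) i| - |S i|) ≤ a * max (|X (T + k) i| - |S i|) 0 :=
        (mul_le_mul_of_nonneg_left (le_max_left _ _) hc0).trans
          (mul_le_mul_of_nonneg_right (hca i) (le_max_right _ _))
      have t3 : 0 ≤ η * (ρ * (N (T + k) - r)) * |S i| :=
        mul_nonneg (mul_nonneg hη.le (mul_nonneg hρ.le (by linarith))) (abs_nonneg _)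
      have t4 : cc * |S i| + η * μ i * |S i| + η * (ρ * (N (T + k) - r)) * |S i| = |S i| := by
        rw [hcc]; ring
      linarith
  have hg : 0 < η * (ρ * q ^ 2 - σ) := mul_pos hη (by linarith)
  have hlin : ∀ k : ℕ, V k ≤ V 0 - k * (η * (ρ * q ^ 2 - σ)) := by
    intro k
    induction k with
    | zero => simp
    | succ k ih => push_cast; linarith [hstep k]
  obtain ⟨k, hk⟩ := exists_nat_gt (V 0 / (η * (ρ * q ^ 2 - σ)))
  rw [div_lt_iff₀ hg] at hk
  linarith [hlin k, hVq k]

end Box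

/-! ### Bounded runs, the weight representation, and the descent inequality. -/

section Descent

variable {d : ℕ} {A : Matrix (Fin d) (Fin d) ℝ} {b c s x₀ : EuclideanSpace ℝ (Fin d)}
  {ρ β η R : ℝ}

/-- Standing assumptions on a run of gradient descent: `R` bounds the norm of all iterates. -/
structure BoundedRun (A : Matrix (Fin d) (Fin d) ℝ) (c : EuclideanSpace ℝ (Fin d))
    (ρ β η R : ℝ) (x₀ : EuclideanSpace ℝ (Fin d)) : Prop where
  symm : A.IsSymm
  rho_pos : 0 < ρ
  eta_pos : 0 < η
  norm_le : ‖opOf A‖ ≤ β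
  radius_pos : 0 < R
  radius : β * R + ‖c‖ ≤ ρ * R ^ 2
  step : η * (β + ρ * R) ≤ 4 / 15
  init : Initialization A ρ c x₀

lemma norm_opOf_le (hβ : ‖opOf A‖ ≤ β) (x : EuclideanSpace ℝ (Fin d)) :
    ‖opOf A x‖ ≤ β * ‖x‖ :=
  (opOf A).le_of_opNorm_le hβ x

lemma abs_inner_opOf_le (hβ : ‖opOf A‖ ≤ β) (x : EuclideanSpace ℝ (Fin d)) :
    |inner ℝ x (opOf A x)| ≤ β * ‖x‖ ^ 2 := by
  refine (abs_real_inner_le_norm _ _).trans ?_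
  have := mul_le_mul_of_nonneg_left (norm_opOf_le hβ x) (norm_nonneg x)
  linarith

/-- A nonnegative number below the positive root of `ρ r² + q r = n` satisfies the inequality. -/
lemma quadratic_le_of_le_root {q n r : ℝ} (hρ : 0 < ρ) (hn : 0 ≤ n) (hr : 0 ≤ r)
    (h : r ≤ -(q / (2 * ρ)) + √((q / (2 * ρ)) ^ 2 + n / ρ)) : ρ * r ^ 2 + q * r ≤ n := by
  set p := q / (2 * ρ) with hp
  have hq : q = 2 * ρ * p := by rw [hp]; field_simp
  have hn' : n = ρ * (n / ρ) := by field_simp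
  have hnn : 0 ≤ n / ρ := div_nonneg hn hρ.le
  have key : r ^ 2 + 2 * p * r ≤ n / ρ := by
    rcases le_or_gt 0 (r + p) with h0 | h0
    · have h1 : r + p ≤ √(p ^ 2 + n / ρ) := by linarith
      have h2 := pow_le_pow_left₀ h0 h1 2
      rw [Real.sq_sqrt (by positivity)] at h2
      linarith
    · nlinarith
  rw [hn', hq]
  nlinarith

lemma initialization_bounds (hρ : 0 < ρ) (hx : Initialization A ρ c x₀) :
    ∃ k : ℝ, 0 ≤ k ∧ x₀ = -(k • c) ∧
      ρ * (k * ‖c‖) ^ 2 * ‖c‖ + k * inner ℝ c (opOf A c) ≤ ‖c‖ ^ 2 := by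
  obtain ⟨r, hr0, hr, hx⟩ := hx
  refine ⟨r / ‖c‖, div_nonneg hr0 (norm_nonneg _), hx, ?_⟩
  rcases eq_or_ne c 0 with rfl | hc
  · simp
  have hc' : 0 < ‖c‖ := norm_pos_iff.2 hc
  have h := quadratic_le_of_le_root (q := inner ℝ c (opOf A c) / ‖c‖ ^ 2) hρ (norm_nonneg c) hr0
    (by
      refine hr.trans (le_of_eq ?_)
      rw [cauchyRadius, div_div, neg_div, mul_comm (‖c‖ ^ 2) (2 * ρ)])
  have h2 := mul_le_mul_of_nonneg_right h hc'.le
  have e : r / ‖c‖ * ‖c‖ = r := by field_simp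
  rw [e]
  refine le_trans (le_of_eq ?_) (h2.trans (le_of_eq (by ring)))
  field_simp

namespace BoundedRun

lemma beta_nonneg (h : BoundedRun A c ρ β η R x₀) : 0 ≤ β := (_root_.norm_nonneg _).trans h.norm_le

lemma norm_init_le (h : BoundedRun A c ρ β η R x₀) : ‖x₀‖ ≤ R := by
  obtain ⟨k, hk, hx, hq⟩ := initialization_bounds h.rho_pos h.init
  have hn : ‖x₀‖ = k * ‖c‖ := by rw [hx, norm_neg, norm_smul, Real.norm_of_nonneg hk]
  rw [hn]
  by_contra! hlt
  have hc : 0 < ‖c‖ := by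
    rcases (norm_nonneg c).eq_or_lt with h0 | h0
    · rw [← h0, mul_zero] at hlt; linarith [h.radius_pos]
    · exact h0
  have h1 := neg_le_of_abs_le (abs_inner_opOf_le h.norm_le c)
  set r := k * ‖c‖ with hr
  have h2 : ρ * r ^ 2 - β * r ≤ ‖c‖ := by
    have h3 : (ρ * r ^ 2 - β * r) * ‖c‖ ≤ ‖c‖ * ‖c‖ := by
      have := mul_le_mul_of_nonneg_left h1 hk
      nlinarith
    exact le_of_mul_le_mul_right h3 hc
  have h4 : β ≤ ρ * R := by
    have : β * R ≤ ρ * R * R := by nlinarith [h.radius]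
    exact le_of_mul_le_mul_right this h.radius_pos
  have h5 := h.radius
  -- `z ↦ ρ z² - β z` increases strictly beyond `R`, since `β ≤ ρ R`.
  have h6 : 0 < (r - R) * (ρ * (r + R) - β) := by
    refine mul_pos (by linarith) ?_
    nlinarith [mul_pos h.rho_pos (h.radius_pos.trans hlt)]
  nlinarith

/-- The norm after a step from norm `N` is at most `φ(N) = N + ηβN - ηρN² + η‖c‖`. The radius
condition says `φ(R) ≤ R`, and the step size makes `φ(N) ≤ φ(R)` for `N ≤ R`. -/
lemma norm_le_radius (h : BoundedRun A c ρ β η R x₀) (t : ℕ) :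
    ‖gdIter A c ρ η x₀ t‖ ≤ R := by
  induction t with
  | zero => exact h.norm_init_le
  | succ t ih =>
    rw [gdIter_succ h.symm]
    set x := gdIter A c ρ η x₀ t
    have hη := h.eta_pos
    have hρ := h.rho_pos
    have hN := norm_nonneg x
    have hβ := h.beta_nonneg
    have hs := h.step
    have h1 : η * (ρ * ‖x‖) ≤ η * (ρ * R) := by gcongr
    have h1' : 0 ≤ η * β := by positivity
    have h2 : x - η • (opOf A x + c + (ρ * ‖x‖) • x) =
        (1 - η * (ρ * ‖x‖)) • x - η • opOf A x - η • c := by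
      module
    rw [h2]
    have h3 : ‖(1 - η * (ρ * ‖x‖)) • x - η • opOf A x - η • c‖ ≤
        (1 - η * (ρ * ‖x‖)) * ‖x‖ + η * (β * ‖x‖) + η * ‖c‖ := by
      refine (norm_sub_le _ _).trans (add_le_add ((norm_sub_le _ _).trans (add_le_add ?_ ?_)) ?_)
      · rw [norm_smul, Real.norm_of_nonneg (by linarith)]
      · rw [norm_smul, Real.norm_of_nonneg hη.le]
        exact mul_le_mul_of_nonneg_left (norm_opOf_le h.norm_le x) hη.le
      · rw [norm_smul, Real.norm_of_nonneg hη.le]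
    refine h3.trans ?_
    have h4 := mul_le_mul_of_nonneg_left h.radius hη.le
    have h5 : 0 ≤ (R - ‖x‖) * (1 + η * β - η * (ρ * R) - η * (ρ * ‖x‖)) :=
      mul_nonneg (by linarith) (by linarith)
    nlinarith

end BoundedRun

lemma inner_eigenvector_opOf (hA : A.IsSymm)
    {e : OrthonormalBasis (Fin d) ℝ (EuclideanSpace ℝ (Fin d))} {lam : Fin d → ℝ}
    (he : ∀ i, opOf A (e i) = lam i • e i) (i : Fin d) (x : EuclideanSpace ℝ (Fin d)) :
    inner ℝ (e i) (opOf A x) = lam i * inner ℝ (e i) x := by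
  rw [← opOf_isSymmetric hA, he, real_inner_smul_left]

lemma eigenvalue_le {e : OrthonormalBasis (Fin d) ℝ (EuclideanSpace ℝ (Fin d))} {lam : Fin d → ℝ}
    (he : ∀ i, opOf A (e i) = lam i • e i) (hβ : ‖opOf A‖ ≤ β) (i : Fin d) : lam i ≤ β := by
  have h := norm_opOf_le hβ (e i)
  rw [he, norm_smul, e.norm_eq_one, mul_one, mul_one] at h
  exact (le_abs_self _).trans h

lemma norm_sq_eq_sum_inner_sq (e : OrthonormalBasis (Fin d) ℝ (EuclideanSpace ℝ (Fin d)))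
    (x : EuclideanSpace ℝ (Fin d)) : ‖x‖ ^ 2 = ∑ i, (inner ℝ (e i) x) ^ 2 := by
  rw [← e.sum_sq_norm_inner_right x]
  exact Finset.sum_congr rfl fun i _ => by rw [Real.norm_eq_abs, sq_abs]

lemma norm_eq_sqrt_sum_inner_sq (e : OrthonormalBasis (Fin d) ℝ (EuclideanSpace ℝ (Fin d)))
    (x : EuclideanSpace ℝ (Fin d)) : ‖x‖ = √(∑ i, (inner ℝ (e i) x) ^ 2) := by
  rw [← norm_sq_eq_sum_inner_sq, Real.sqrt_sq (norm_nonneg _)]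

/-- Weights of the iterates in an eigenbasis. -/
def weight (lam : Fin d → ℝ) (η ρ k : ℝ) (N : ℕ → ℝ) : ℕ → Fin d → ℝ
  | 0, _ => k
  | t + 1, i => (1 - η * lam i - η * ρ * N t) * weight lam η ρ k N t i + η

lemma inner_gdIter_eq_weight (hA : A.IsSymm)
    {e : OrthonormalBasis (Fin d) ℝ (EuclideanSpace ℝ (Fin d))} {lam : Fin d → ℝ}
    (he : ∀ i, opOf A (e i) = lam i • e i) {k : ℝ} (t : ℕ) (i : Fin d) :
    inner ℝ (e i) (gdIter A c ρ η (-(k • c)) t) =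
      -(weight lam η ρ k (fun t => ‖gdIter A c ρ η (-(k • c)) t‖) t i * inner ℝ (e i) c) := by
  induction t with
  | zero => simp [gdIter, weight, real_inner_smul_right]
  | succ t ih =>
    rw [gdIter_succ hA, inner_sub_right, real_inner_smul_right, inner_add_right, inner_add_right,
      inner_eigenvector_opOf hA he, real_inner_smul_right, ih, weight]
    ring

namespace BoundedRun

variable {e : OrthonormalBasis (Fin d) ℝ (EuclideanSpace ℝ (Fin d))} {lam : Fin d → ℝ}

lemma damping_ge (h : BoundedRun A c ρ β η R x₀) (he : ∀ i, opOf A (e i) = lam i • e i)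
    (t : ℕ) (i : Fin d) :
    11 / 15 ≤ 1 - η * lam i - η * ρ * ‖gdIter A c ρ η x₀ t‖ := by
  have h1 := mul_le_mul_of_nonneg_left (eigenvalue_le he h.norm_le i) h.eta_pos.le
  have h2 := mul_le_mul_of_nonneg_left (h.norm_le_radius t) (mul_pos h.eta_pos h.rho_pos).le
  linarith [h.step]

lemma eta_rho_norm_le (h : BoundedRun A c ρ β η R x₀) (t : ℕ) :
    η * ρ * ‖gdIter A c ρ η x₀ t‖ ≤ 4 / 15 := by
  have h2 := mul_le_mul_of_nonneg_left (h.norm_le_radius t) (mul_pos h.eta_pos h.rho_pos).le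
  linarith [h.step, mul_nonneg h.eta_pos.le h.beta_nonneg]

/-- The norms of the gradient descent iterates are nondecreasing. -/
lemma norm_monotone (h : BoundedRun A c ρ β η R x₀) (he : ∀ i, opOf A (e i) = lam i • e i) :
    Monotone fun t => ‖gdIter A c ρ η x₀ t‖ := by
  have hD := h.damping_ge he
  have hNb := h.eta_rho_norm_le
  obtain ⟨k, hk, hx, hq⟩ := initialization_bounds h.rho_pos h.init
  subst hx
  refine norm_monotone_of_weights (w := weight lam η ρ k _) (c := fun i => inner ℝ (e i) c)
    h.eta_pos h.rho_pos (fun t i => rfl) hD hk (fun i => rfl) (fun t => norm_nonneg _)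
    (fun t => ?_) hNb ?_
  · rw [norm_sq_eq_sum_inner_sq e]
    exact Finset.sum_congr rfl fun i _ => by rw [inner_gdIter_eq_weight h.symm he, neg_sq]
  · have hn : ‖-(k • c)‖ = k * ‖c‖ := by rw [norm_neg, norm_smul, Real.norm_of_nonneg hk]
    have e1 : inner ℝ c (opOf A c) = ∑ i, lam i * (inner ℝ (e i) c) ^ 2 := by
      rw [← e.sum_inner_mul_inner]
      refine Finset.sum_congr rfl fun i _ => ?_
      rw [inner_eigenvector_opOf h.symm he, real_inner_comm]
      ring
    -- The initial increment sum is the derivative condition along `-c`; its sign is exactly what a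
    -- start within the Cauchy radius guarantees.
    have e2 : ∑ i, (inner ℝ (e i) c) ^ 2 * (k * (((1 - η * lam i - η * ρ * (k * ‖c‖)) * k + η) - k))
        = η * k * (‖c‖ ^ 2 - k * inner ℝ c (opOf A c) - ρ * (k * ‖c‖) * k * ‖c‖ ^ 2) := by
      rw [e1, norm_sq_eq_sum_inner_sq e c]
      simp only [Finset.mul_sum, ← Finset.sum_sub_distrib]
      exact Finset.sum_congr rfl fun i _ => by ring
    simp only [weight, gdIter, hn]
    rw [e2]
    refine mul_nonneg (mul_nonneg h.eta_pos.le hk) ?_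
    linarith

/-- Growth of the iterates along the eigenvector of a negative eigenvalue. -/
lemma pow_sub_one_le (h : BoundedRun A c ρ β η R x₀) (he : ∀ i, opOf A (e i) = lam i • e i)
    (i : Fin d) {δ : ℝ} (hδ : 0 < δ) (t : ℕ)
    (hN : ∀ k ≤ t, ρ * ‖gdIter A c ρ η x₀ k‖ ≤ -lam i - δ) :
    ρ * |inner ℝ (e i) c| * ((1 + η * δ) ^ t - 1) ≤ lam i ^ 2 / 4 := by
  have hlast := hN t le_rfl
  obtain ⟨k, hk, hx, -⟩ := initialization_bounds h.rho_pos h.init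
  subst hx
  obtain ⟨h1, h2⟩ := weight_growth (w := weight lam η ρ k _) h.eta_pos (fun t i => rfl)
    (fun _ => hk) hδ i t (fun k hk => hN k hk.le)
  have h3 := abs_real_inner_le_norm (e i) (gdIter A c ρ η (-(k • c)) t)
  rw [inner_gdIter_eq_weight h.symm he, abs_neg, abs_mul, abs_of_nonneg h2, e.norm_eq_one,
    one_mul] at h3
  have hρ := h.rho_pos
  have h4 := mul_le_mul_of_nonneg_left h1 (mul_nonneg hρ.le (abs_nonneg (inner ℝ (e i) c)))
  have h5 := mul_le_mul_of_nonneg_left h3 (mul_pos hδ hρ).le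
  have h6 := mul_le_mul_of_nonneg_left hlast hδ.le
  -- `δ(-lam i - δ) ≤ lam i ^ 2 / 4`, by completing the square.
  nlinarith [sq_nonneg (lam i + 2 * δ)]

/-- Comparison of the iterates with the minimizer `s` of the problem with linear term `b`. -/
lemma norm_le_of_norm_sub (h : BoundedRun A c ρ β η R x₀)
    (he : ∀ i, opOf A (e i) = lam i • e i) (hs : opOf A s + b + (ρ * ‖s‖) • s = 0)
    (hs2 : ∀ i, 0 ≤ lam i + ρ * ‖s‖) {q : ℝ} (hq : 0 < q) (hcb : ‖c - b‖ < ρ * q ^ 2) (t : ℕ) :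
    ‖gdIter A c ρ η x₀ t‖ ≤ ‖s‖ + q := by
  refine norm_le_of_perturbed_recursion (μ := fun i => lam i + ρ * ‖s‖)
    (X := fun t i => inner ℝ (e i) (gdIter A c ρ η x₀ t)) (S := fun i => inner ℝ (e i) s)
    (err := fun i => inner ℝ (e i) (c - b)) (N := fun t => ‖gdIter A c ρ η x₀ t‖)
    h.eta_pos h.rho_pos hq hcb (fun t i => ?_) (fun t i => ?_) hs2
    (fun t => norm_eq_sqrt_sum_inner_sq e _) (norm_eq_sqrt_sum_inner_sq e _)
    (norm_eq_sqrt_sum_inner_sq e _).symm (h.norm_monotone he) t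
  · have h0 : inner ℝ (e i) (opOf A s + b + (ρ * ‖s‖) • s) = 0 := by rw [hs, inner_zero_right]
    rw [inner_add_right, inner_add_right, inner_eigenvector_opOf h.symm he,
      real_inner_smul_right] at h0
    rw [gdIter_succ h.symm, inner_sub_right, real_inner_smul_right, inner_add_right,
      inner_add_right, inner_eigenvector_opOf h.symm he, real_inner_smul_right, inner_sub_right]
    linear_combination (-η) * h0
  · have := h.damping_ge he t i
    linarith

end BoundedRun

/-- Exact second-order expansion of the cubic model. -/
lemma cubic_add_sub (hA : A.IsSymm) (x p : EuclideanSpace ℝ (Fin d)) :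
    cubic A c ρ (x + p) - cubic A c ρ x =
      inner ℝ (opOf A x + c + (ρ * ‖x‖) • x) p + 1 / 2 * inner ℝ p (opOf A p) +
        ρ / 3 * ((‖x + p‖ - ‖x‖) ^ 2 * (‖x + p‖ + ‖x‖ / 2) + 3 / 2 * ‖x‖ * ‖p‖ ^ 2) := by
  have h1 : ‖x + p‖ ^ 2 = ‖x‖ ^ 2 + 2 * inner ℝ x p + ‖p‖ ^ 2 := norm_add_sq_real x p
  have h3 := opOf_isSymmetric hA x p
  have h6 := real_inner_comm (opOf A x) p
  simp only [cubic, map_add, inner_add_left, inner_add_right, real_inner_smul_left]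
  linear_combination (1 / 2) * ρ * ‖x‖ * h1 - 1 / 2 * h3 + (1 / 2) * h6

/-- Alignment of the gradient with the direction to the minimizer. -/
lemma inner_sub_gradient (hs : opOf A s + b + (ρ * ‖s‖) • s = 0)
    (x : EuclideanSpace ℝ (Fin d)) :
    inner ℝ (x - s) (opOf A x + b + (ρ * ‖x‖) • x) =
      inner ℝ (x - s) (opOf A (x - s)) + ρ * ‖s‖ * ‖x - s‖ ^ 2 +
        ρ / 2 * (‖x‖ - ‖s‖) * ‖x - s‖ ^ 2 + ρ / 2 * (‖s‖ - ‖x‖) ^ 2 * (‖s‖ + ‖x‖) := by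
  have h1 : inner ℝ (x - s) (opOf A s + b + (ρ * ‖s‖) • s) = 0 := by rw [hs, inner_zero_right]
  have h2 : ‖x - s‖ ^ 2 = ‖x‖ ^ 2 - 2 * inner ℝ x s + ‖s‖ ^ 2 := norm_sub_sq_real x s
  have h5 := real_inner_comm x s
  simp only [inner_add_right, inner_sub_left, real_inner_smul_right, map_sub, inner_sub_right,
    real_inner_self_eq_norm_sq] at h1 ⊢
  rw [h2]
  linear_combination h1 - ρ * ‖x‖ * h5

/-- Both endpoints lie in the ball of radius `R`, so the curvature along the step `p` costs at most
`(β + ρR)‖p‖²`. The linear term is `-‖p‖²/η`, and `η(β + ρR) ≤ 4/15` leaves the factor `11/15`. -/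
lemma BoundedRun.descent (h : BoundedRun A c ρ β η R x₀) (t : ℕ) :
    ‖gdIter A c ρ η x₀ (t + 1) - gdIter A c ρ η x₀ t‖ ^ 2 ≤
      15 / 11 * η * (cubic A c ρ (gdIter A c ρ η x₀ t) -
        cubic A c ρ (gdIter A c ρ η x₀ (t + 1))) := by
  have hN := h.norm_le_radius t
  have hN' := h.norm_le_radius (t + 1)
  have hη := h.eta_pos
  have hρ := h.rho_pos
  set x := gdIter A c ρ η x₀ t with hx
  set x' := gdIter A c ρ η x₀ (t + 1) with hx'
  set p := x' - x with hp
  have hxp : x + p = x' := by rw [hp]; abel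
  have hg : p = -(η • (opOf A x + c + (ρ * ‖x‖) • x)) := by
    rw [hp, hx', gdIter_succ h.symm, ← hx]; abel
  have h1 := cubic_add_sub (c := c) (ρ := ρ) h.symm x p
  rw [hxp] at h1
  have h2 : ‖p‖ ^ 2 = -(η * inner ℝ (opOf A x + c + (ρ * ‖x‖) • x) p) := by
    rw [← real_inner_self_eq_norm_sq]
    nth_rewrite 1 [hg]
    rw [inner_neg_left, real_inner_smul_left]
  have h3 := le_of_abs_le (abs_inner_opOf_le h.norm_le p)
  have h4 : (‖x'‖ - ‖x‖) ^ 2 ≤ ‖p‖ ^ 2 := by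
    rw [← sq_abs]
    exact pow_le_pow_left₀ (abs_nonneg _) (abs_norm_sub_norm_le x' x) 2
  have h5 : (‖x'‖ - ‖x‖) ^ 2 * (‖x'‖ + ‖x‖ / 2) + 3 / 2 * ‖x‖ * ‖p‖ ^ 2 ≤ 3 * R * ‖p‖ ^ 2 := by
    have t1 := mul_le_mul_of_nonneg_right h4
      (add_nonneg (norm_nonneg x') (div_nonneg (norm_nonneg x) zero_le_two))
    have t2 : ‖p‖ ^ 2 * (‖x'‖ + 2 * ‖x‖) ≤ ‖p‖ ^ 2 * (3 * R) :=
      mul_le_mul_of_nonneg_left (by linarith) (sq_nonneg _)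
    linarith
  have h6 := mul_le_mul_of_nonneg_left h5 (by positivity : 0 ≤ ρ / 3)
  have h7 : cubic A c ρ x' - cubic A c ρ x ≤
      inner ℝ (opOf A x + c + (ρ * ‖x‖) • x) p + (β + ρ * R) * ‖p‖ ^ 2 := by
    have := mul_nonneg h.beta_nonneg (sq_nonneg ‖p‖)
    linarith
  have h8 := mul_le_mul_of_nonneg_left h7 hη.le
  have h9 := mul_le_mul_of_nonneg_right h.step (sq_nonneg ‖p‖)
  linarith

end Descent

/-! ### Scalar inequalities for the contraction phase. -/

section Scalar

/-- While the optimality gap `F` exceeds `ε`, the alignment `Q` of the gradient dominates both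
the perturbation `E` and the squared distance `Y²` to the minimizer. -/
lemma alignment_ge {ρ r N Y H Q F E μ m ε : ℝ} (hρ : 0 < ρ) (hr : 0 ≤ r) (hN0 : 0 ≤ N)
    (hN : N ≤ 5 / 4 * r) (hY0 : 0 ≤ Y) (hY : Y ≤ r + N) (hμ0 : 0 ≤ μ) (hH : μ * Y ^ 2 ≤ H)
    (hQ : Q = H + ρ / 2 * (N - r) * Y ^ 2 + ρ / 2 * (r - N) ^ 2 * (r + N))
    (hF : F = 1 / 2 * H + ρ / 6 * (r - N) ^ 2 * (r + 2 * N))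
    (hm : m = μ ∨ μ ≤ m ∧ 10 * m * r ^ 2 ≤ ε) (hNm : ρ * r - μ - m / 3 ≤ ρ * N)
    (hE : E ≤ ε / 10) (hFε : ε < F) (hε : 0 < ε) : m / 4 * Y ^ 2 ≤ Q - E := by
  have hm0 : 0 ≤ m := by rcases hm with rfl | ⟨h, -⟩ <;> linarith
  have hY2 : Y ^ 2 ≤ (r + N) ^ 2 := pow_le_pow_left₀ hY0 hY 2
  have hYsq := sq_nonneg Y
  have hD := sq_nonneg (r - N)
  have hH0 : 0 ≤ H := le_trans (by positivity) hH
  rcases le_total r N with hrN | hrN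
  · have h1 : 0 ≤ ρ * (N - r) * Y ^ 2 := mul_nonneg (mul_nonneg hρ.le (by linarith)) hYsq
    have h2 : 0 ≤ ρ * (r - N) ^ 2 * r := by positivity
    have h2' : 0 ≤ ρ * (r - N) ^ 2 * N := by positivity
    have hQF : 3 / 2 * F ≤ Q := by rw [hQ, hF]; linarith
    have hQH : H ≤ Q := by rw [hQ]; linarith
    rcases hm with rfl | ⟨hm1, hm2⟩
    · have : 0 ≤ m * Y ^ 2 := by positivity
      linarith
    · have h3 : (r + N) ^ 2 ≤ (9 / 4 * r) ^ 2 := pow_le_pow_left₀ (by linarith) (by linarith) 2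
      have h4 := mul_le_mul_of_nonneg_left (hY2.trans h3) hm0
      linarith
  · have h3 : (r + N) ^ 2 ≤ (2 * r) ^ 2 := pow_le_pow_left₀ (by linarith) (by linarith) 2
    have h4 : ρ * (r - N) * Y ^ 2 ≤ (μ + m / 3) * Y ^ 2 :=
      mul_le_mul_of_nonneg_right (by linarith) hYsq
    have h5 : 0 ≤ ρ * (r - N) ^ 2 * (r - N) := by
      have : 0 ≤ r - N := by linarith
      positivity
    have hQF : 2 * F - ρ / 2 * (r - N) * Y ^ 2 ≤ Q := by rw [hQ, hF]; linarith
    have h6 : 0 ≤ ρ * (r - N) ^ 2 * (r + N) := by positivity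
    rcases hm with rfl | ⟨hm1, hm2⟩
    · have h7 : m / 3 * Y ^ 2 ≤ Q := by rw [hQ]; linarith
      -- The bounds `Q ≥ m/3 Y²` and `Q ≥ 2F - 2m/3 Y²`, weighted by `11/12` and `1/12`, give `Q ≥
      -- m/4 Y² + F/6`, and `E < F/10`.
      linarith
    · have h8 := mul_le_mul_of_nonneg_left (hY2.trans h3) hm0
      have h9 := mul_le_mul_of_nonneg_right hm1 hYsq
      linarith

lemma log_four_point_one_two_le : Real.log 4.12 ≤ 9 / 4 * Real.log 2 := by
  have h : Real.log ((4.12 : ℝ) ^ 4) ≤ Real.log ((2 : ℝ) ^ 9) :=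
    Real.log_le_log (by norm_num) (by norm_num)
  rw [Real.log_pow, Real.log_pow] at h
  push_cast at h
  linarith

end Scalar

/-! ### Growth phase, contraction phase, and their total duration. -/

section Convergence

variable {d : ℕ} {A : Matrix (Fin d) (Fin d) ℝ} {b c s x₀ : EuclideanSpace ℝ (Fin d)}
  {ρ β η R : ℝ} {e : OrthonormalBasis (Fin d) ℝ (EuclideanSpace ℝ (Fin d))} {lam : Fin d → ℝ}
  {i₀ : Fin d}

lemma curvature_ge (hA : A.IsSymm) (he : ∀ i, opOf A (e i) = lam i • e i)
    (hmin : ∀ i, lam i₀ ≤ lam i) (y : EuclideanSpace ℝ (Fin d)) :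
    lam i₀ * ‖y‖ ^ 2 ≤ inner ℝ y (opOf A y) := by
  rw [← e.sum_inner_mul_inner, norm_sq_eq_sum_inner_sq e, Finset.mul_sum]
  refine Finset.sum_le_sum fun i _ => ?_
  rw [inner_eigenvector_opOf hA he, real_inner_comm (e i) y]
  have := mul_le_mul_of_nonneg_right (hmin i) (sq_nonneg (inner ℝ (e i) y))
  linarith

lemma cubic_sub_cubic_linear (x : EuclideanSpace ℝ (Fin d)) :
    cubic A c ρ x - cubic A b ρ x = inner ℝ (c - b) x := by
  simp only [cubic, inner_sub_left]; ring

/-- One step contracts the potential `‖x - s‖² + (15/11) η (f̃(x) - f̃(s))`. -/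
lemma BoundedRun.potential_step (h : BoundedRun A c ρ β η R x₀) (t : ℕ) :
    ‖gdIter A c ρ η x₀ (t + 1) - s‖ ^ 2 +
        15 / 11 * η * (cubic A c ρ (gdIter A c ρ η x₀ (t + 1)) - cubic A c ρ s) ≤
      ‖gdIter A c ρ η x₀ t - s‖ ^ 2 +
        15 / 11 * η * (cubic A c ρ (gdIter A c ρ η x₀ t) - cubic A c ρ s) -
      2 * η * (inner ℝ (gdIter A c ρ η x₀ t - s)
        (opOf A (gdIter A c ρ η x₀ t) + b + (ρ * ‖gdIter A c ρ η x₀ t‖) • gdIter A c ρ η x₀ t) -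
        ‖c - b‖ * ‖gdIter A c ρ η x₀ t - s‖) := by
  have h1 := h.descent t
  have hsucc := gdIter_succ h.symm c ρ η x₀ t
  set x := gdIter A c ρ η x₀ t
  set x' := gdIter A c ρ η x₀ (t + 1)
  have hp : x' - x = -(η • ((opOf A x + b + (ρ * ‖x‖) • x) + (c - b))) := by
    rw [hsucc]; module
  have h2 : ‖x' - s‖ ^ 2 = ‖x - s‖ ^ 2 + 2 * inner ℝ (x - s) (x' - x) + ‖x' - x‖ ^ 2 := by
    rw [← norm_add_sq_real]; congr 2; abel
  have h3 : inner ℝ (x - s) (x' - x) =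
      -(η * (inner ℝ (x - s) (opOf A x + b + (ρ * ‖x‖) • x) + inner ℝ (x - s) (c - b))) := by
    rw [hp, inner_neg_right, real_inner_smul_right, inner_add_right]
  have h4 := neg_le_of_abs_le (abs_real_inner_le_norm (x - s) (c - b))
  have h5 := mul_le_mul_of_nonneg_left h4 h.eta_pos.le
  rw [h2, h3]
  linarith

/-- If along a run the gap never drops to `ε`, the potential decays geometrically. -/
lemma BoundedRun.gap_decay (h : BoundedRun A c ρ β η R x₀)
    (he : ∀ i, opOf A (e i) = lam i • e i) (hmin : ∀ i, lam i₀ ≤ lam i)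
    (hs : opOf A s + b + (ρ * ‖s‖) • s = 0) (hμ : 0 ≤ lam i₀ + ρ * ‖s‖) (hsR : ‖s‖ ≤ R)
    (hNs : ∀ t, ‖gdIter A c ρ η x₀ t‖ ≤ 5 / 4 * ‖s‖) {ε m : ℝ} (hε : 0 < ε)
    (hcb : ‖c - b‖ * (9 / 4 * ‖s‖) ≤ ε / 10)
    (hm : m = lam i₀ + ρ * ‖s‖ ∨ lam i₀ + ρ * ‖s‖ ≤ m ∧ 10 * m * ‖s‖ ^ 2 ≤ ε)
    (hηm : η * m ≤ 1) {t₀ : ℕ} (n : ℕ)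
    (hgrow : ∀ k, t₀ ≤ k → -lam i₀ - m / 3 ≤ ρ * ‖gdIter A c ρ η x₀ k‖)
    (hgap : ∀ k, k ≤ t₀ + n → ε < cubic A b ρ (gdIter A c ρ η x₀ k) - cubic A b ρ s) :
    ε < 4.12 * (β + 2 * ρ * ‖s‖) * ‖s‖ ^ 2 * (1 - η * m / 3) ^ n := by
  have hη := h.eta_pos
  have hρ := h.rho_pos
  have hβ := h.beta_nonneg
  set r := ‖s‖ with hr
  have hr0 : 0 ≤ r := norm_nonneg s
  set x := gdIter A c ρ η x₀
  set L := β + 2 * ρ * r with hL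
  have hL0 : 0 ≤ L := by positivity
  have hηL : η * L ≤ 8 / 15 := by
    have h1 : η * (ρ * r) ≤ η * (ρ * R) := by gcongr
    have h2 : 0 ≤ η * β := by positivity
    rw [hL]; linarith [h.step]
  set Φ : ℕ → ℝ := fun k => ‖x k - s‖ ^ 2 + 15 / 11 * η * (cubic A c ρ (x k) - cubic A c ρ s)
    with hΦ
  have hm0 : 0 ≤ m := by rcases hm with h | ⟨h, -⟩ <;> linarith
  have hYn : ∀ k, ‖x k - s‖ ≤ r + ‖x k‖ := fun k => by
    rw [add_comm]; exact norm_sub_le _ _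
  have hE : ∀ k, ‖c - b‖ * ‖x k - s‖ ≤ ε / 10 := fun k =>
    (mul_le_mul_of_nonneg_left ((hYn k).trans (by linarith [hNs k])) (norm_nonneg _)).trans hcb
  have hG : ∀ k, |cubic A c ρ (x k) - cubic A c ρ s - (cubic A b ρ (x k) - cubic A b ρ s)| ≤
      ε / 10 := by
    intro k
    have : cubic A c ρ (x k) - cubic A c ρ s - (cubic A b ρ (x k) - cubic A b ρ s) =
        inner ℝ (c - b) (x k - s) := by
      rw [inner_sub_right, ← cubic_sub_cubic_linear (A := A) (ρ := ρ),
        ← cubic_sub_cubic_linear (A := A) (ρ := ρ)]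
      ring
    rw [this]
    exact (abs_real_inner_le_norm _ _).trans (hE k)
  have hFY : ∀ k, cubic A b ρ (x k) - cubic A b ρ s ≤ 13 / 24 * L * ‖x k - s‖ ^ 2 := by
    intro k
    rw [cubic_sub_cubic h.symm hs]
    have h1 := le_of_abs_le (abs_inner_opOf_le h.norm_le (x k - s))
    have h2 : (r - ‖x k‖) ^ 2 ≤ ‖x k - s‖ ^ 2 := by
      rw [← sq_abs, abs_sub_comm]
      exact pow_le_pow_left₀ (abs_nonneg _) (abs_norm_sub_norm_le _ _) 2
    have h3 : (r - ‖x k‖) ^ 2 * (r + 2 * ‖x k‖) ≤ ‖x k - s‖ ^ 2 * (7 / 2 * r) :=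
      mul_le_mul h2 (by linarith [hNs k]) (by positivity) (by positivity)
    have h4 := mul_le_mul_of_nonneg_left h3 (by positivity : 0 ≤ ρ / 6)
    have h5 : 0 ≤ β * ‖x k - s‖ ^ 2 := by positivity
    rw [hL]
    linarith
  have hΦle : ∀ k, k ≤ t₀ + n → Φ k ≤ 3 / 2 * ‖x k - s‖ ^ 2 := by
    intro k hk
    have h1 := le_of_abs_le (hG k)
    have h2 := hgap k hk
    have h3 : cubic A c ρ (x k) - cubic A c ρ s ≤ 11 / 10 * (13 / 24 * L * ‖x k - s‖ ^ 2) := by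
      linarith [hFY k]
    have h4 := mul_le_mul_of_nonneg_left h3 hη.le
    have h5 := mul_le_mul_of_nonneg_right hηL (sq_nonneg ‖x k - s‖)
    have h6 := sq_nonneg ‖x k - s‖
    simp only [hΦ]
    linarith
  have hΦge : ∀ k, k ≤ t₀ + n → ‖x k - s‖ ^ 2 ≤ Φ k := by
    intro k hk
    have h1 := neg_le_of_abs_le (hG k)
    have h2 := hgap k hk
    have h3 : 0 ≤ cubic A c ρ (x k) - cubic A c ρ s := by linarith
    have := mul_nonneg hη.le h3
    simp only [hΦ]
    linarith
  have hstep : ∀ k, t₀ ≤ k → k ≤ t₀ + n → Φ (k + 1) ≤ (1 - η * m / 3) * Φ k := by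
    intro k hk hk'
    have h1 := h.potential_step (b := b) (s := s) k
    have hHk := curvature_ge h.symm he hmin (x k - s)
    have h2 := alignment_ge (ρ := ρ) (r := r) (N := ‖x k‖) (Y := ‖x k - s‖)
      (H := inner ℝ (x k - s) (opOf A (x k - s)) + ρ * r * ‖x k - s‖ ^ 2)
      (μ := lam i₀ + ρ * r) (m := m) (ε := ε) (E := ‖c - b‖ * ‖x k - s‖) hρ hr0 (norm_nonneg _)
      (hNs k) (norm_nonneg _) (hYn k) hμ (by linarith) (inner_sub_gradient hs (x k))
      (cubic_sub_cubic h.symm hs (x k)) hm (by linarith [hgrow k hk]) (hE k) (hgap k hk') hε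
    have h3 := mul_le_mul_of_nonneg_left h2 hη.le
    have h4 := mul_le_mul_of_nonneg_left (hΦle k hk') (mul_nonneg hη.le hm0)
    simp only [hΦ] at h4 ⊢
    -- The decrease is `2η · m/4 · ‖x - s‖²`, and `‖x - s‖² ≥ 2/3 Φ`; hence the rate `ηm/3`.
    linarith
  have hpow : ∀ k, k ≤ n → Φ (t₀ + k) ≤ (1 - η * m / 3) ^ k * Φ t₀ := by
    intro k
    induction k with
    | zero => simp
    | succ k ih =>
      intro hk
      have h1 := hstep (t₀ + k) (by omega) (by omega)
      have h2 := mul_le_mul_of_nonneg_left (ih (by omega)) (by linarith : 0 ≤ 1 - η * m / 3)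
      rw [pow_succ]
      rw [← add_assoc]
      linarith
  have h1 := hpow n le_rfl
  have h2 := hΦge (t₀ + n) le_rfl
  have h3 := hgap (t₀ + n) le_rfl
  have h4 := hFY (t₀ + n)
  have h5 : Φ t₀ ≤ 3 / 2 * (9 / 4 * r) ^ 2 := by
    refine (hΦle t₀ (by omega)).trans (mul_le_mul_of_nonneg_left ?_ (by norm_num))
    exact pow_le_pow_left₀ (norm_nonneg _) ((hYn t₀).trans (by linarith [hNs t₀])) 2
  have hpw : 0 ≤ (1 - η * m / 3) ^ n := pow_nonneg (by linarith) n
  have h6 := mul_le_mul_of_nonneg_left h5 hpw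
  have h7 := mul_le_mul_of_nonneg_left (h2.trans (h1.trans h6)) (by positivity : 0 ≤ 13 / 24 * L)
  have h8 : 0 ≤ L * r ^ 2 * (1 - η * m / 3) ^ n := by positivity
  -- `13/24 · 3/2 · (9/4)² ≈ 4.113`, rounded up to `4.12`.
  linarith

/-- Number of steps spent before the iterates leave the region of negative curvature. -/
lemma BoundedRun.growth_time (h : BoundedRun A c ρ β η R x₀)
    (he : ∀ i, opOf A (e i) = lam i • e i) (hμ : 0 ≤ lam i₀ + ρ * ‖s‖) {m K : ℝ} (hm : 0 < m)
    (hηm : η * m ≤ 4 / 15) (hc : 0 < |inner ℝ (e i₀) c|)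
    (hK : ρ * ‖s‖ ^ 2 / 4 ≤ |inner ℝ (e i₀) c| * K) (n : ℕ)
    (hN : ∀ k ≤ n, ρ * ‖gdIter A c ρ η x₀ k‖ ≤ -lam i₀ - m / 3) :
    η * m * n ≤ 49 / 15 * Real.log (1 + K) := by
  have h1 := h.pow_sub_one_le he i₀ (by positivity : 0 < m / 3) n hN
  have hρ := h.rho_pos
  have hlam : lam i₀ ≤ 0 := by
    have := hN 0 (Nat.zero_le _)
    have := mul_nonneg hρ.le (norm_nonneg (gdIter A c ρ η x₀ 0))
    linarith
  have h2 : lam i₀ ^ 2 ≤ (ρ * ‖s‖) ^ 2 := by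
    rw [← neg_sq]; exact pow_le_pow_left₀ (by linarith) (by linarith) 2
  have h3 : ρ * |inner ℝ (e i₀) c| * ((1 + η * (m / 3)) ^ n - 1) ≤
      ρ * |inner ℝ (e i₀) c| * K := by
    have := mul_le_mul_of_nonneg_left hK hρ.le
    linarith
  have h4 : (1 + η * (m / 3)) ^ n ≤ 1 + K := by
    linarith [le_of_mul_le_mul_left h3 (mul_pos hρ hc)]
  set v := η * (m / 3) with hv
  have hv0 : 0 < v := mul_pos h.eta_pos (by positivity)
  have h5 := Real.log_le_log (by positivity) h4
  rw [Real.log_pow] at h5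
  -- `ηm ≤ 4/15` gives `v ≤ 4/45`, and `1/(1 + 4/45) = 45/49`.
  have h6 : 45 / 49 * v ≤ Real.log (1 + v) := by
    refine le_trans ?_ (Real.one_sub_inv_le_log_of_pos (by positivity))
    have e1 : 1 - (1 + v)⁻¹ = v / (1 + v) := by field_simp; ring
    rw [e1, le_div_iff₀ (by positivity)]
    have : v ≤ 4 / 45 := by rw [hv]; linarith
    nlinarith
  have h7 := mul_le_mul_of_nonneg_left h6 (Nat.cast_nonneg (α := ℝ) n)
  have h8 : η * m = 3 * v := by rw [hv]; ring
  rw [h8]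
  linarith

/-- Convergence of gradient descent on the perturbed problem, measured in the original
objective. -/
theorem BoundedRun.cubic_le (h : BoundedRun A c ρ β η R x₀)
    (he : ∀ i, opOf A (e i) = lam i • e i) (hmin : ∀ i, lam i₀ ≤ lam i)
    (hs : opOf A s + b + (ρ * ‖s‖) • s = 0) (hμ : 0 ≤ lam i₀ + ρ * ‖s‖) (hs0 : s ≠ 0)
    (hsR : ‖s‖ ≤ R) {ε m σbar τ : ℝ} (hε : 0 < ε)
    (hε' : ε ≤ (β / 2 + ρ * ‖s‖) * ‖s‖ ^ 2) (hσ : 0 < σbar) (hσ' : σbar ≤ 1)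
    (hcb : ‖c - b‖ * (24 * ‖s‖) ≤ ε * σbar) (hcb' : ‖c - b‖ * 24 ≤ ρ * ‖s‖ ^ 2)
    (hm0 : 0 < m)
    (hm : m = lam i₀ + ρ * ‖s‖ ∨ lam i₀ + ρ * ‖s‖ ≤ m ∧ 10 * m * ‖s‖ ^ 2 ≤ ε) {K : ℝ}
    (hc : 0 < |inner ℝ (e i₀) c|)
    (hK : ρ * ‖s‖ ^ 2 / 4 ≤ |inner ℝ (e i₀) c| * K) (hτ0 : 0 ≤ τ)
    (hτ : lam i₀ < 0 → Real.log (1 + K) ≤ τ + tauConverge β ρ ε ‖s‖) {t : ℕ}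
    (ht : 6 * τ + 14 * tauConverge β ρ ε ‖s‖ ≤ η * m * t) :
    cubic A b ρ (gdIter A c ρ η x₀ t) ≤ cubic A b ρ s + (1 + σbar) * ε := by
  by_contra! hlt
  have hη := h.eta_pos
  have hρ := h.rho_pos
  have hβ := h.beta_nonneg
  have hr0 : 0 < ‖s‖ := norm_pos_iff.2 hs0
  have hs2 : ∀ i, 0 ≤ lam i + ρ * ‖s‖ := fun i => by linarith [hmin i]
  have hNs : ∀ k, ‖gdIter A c ρ η x₀ k‖ ≤ 5 / 4 * ‖s‖ := by
    intro k
    -- `q = ‖s‖/4` is admissible because the perturbation is at most `ρ‖s‖²/24 < ρ‖s‖²/16`.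
    have h1 := h.norm_le_of_norm_sub he hs hs2 (q := ‖s‖ / 4) (by positivity)
      (by nlinarith [mul_pos hρ (pow_pos hr0 2)]) k
    linarith
  have hYn : ∀ k, ‖gdIter A c ρ η x₀ k - s‖ ≤ 9 / 4 * ‖s‖ := fun k =>
    (norm_sub_le _ _).trans (by linarith [hNs k])
  have hηm : η * m ≤ 4 / 15 := by
    have hstep : η * (β + ρ * ‖s‖) ≤ 4 / 15 :=
      le_trans (by gcongr) h.step
    refine le_trans (mul_le_mul_of_nonneg_left ?_ hη.le) hstep
    rcases hm with hm | ⟨-, hm⟩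
    · rw [hm]; linarith [eigenvalue_le he h.norm_le i₀]
    · have h1 : 10 * m * ‖s‖ ^ 2 ≤ (β / 2 + ρ * ‖s‖) * ‖s‖ ^ 2 := hm.trans hε'
      have h2 := le_of_mul_le_mul_right h1 (by positivity)
      linarith [mul_nonneg hρ.le hr0.le]
  set E := ‖c - b‖ * (9 / 4 * ‖s‖) with hE
  have hEσ : E ≤ 3 / 32 * (ε * σbar) := by rw [hE]; linarith
  have hεσ : ε * σbar ≤ ε := by nlinarith
  have hεσ0 : 0 < ε * σbar := mul_pos hε hσ
  have hG : ∀ k, |cubic A c ρ (gdIter A c ρ η x₀ k) - cubic A c ρ s -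
      (cubic A b ρ (gdIter A c ρ η x₀ k) - cubic A b ρ s)| ≤ E := by
    intro k
    have : cubic A c ρ (gdIter A c ρ η x₀ k) - cubic A c ρ s -
        (cubic A b ρ (gdIter A c ρ η x₀ k) - cubic A b ρ s) =
        inner ℝ (c - b) (gdIter A c ρ η x₀ k - s) := by
      rw [inner_sub_right, ← cubic_sub_cubic_linear (A := A) (ρ := ρ),
        ← cubic_sub_cubic_linear (A := A) (ρ := ρ)]
      ring
    rw [this]
    exact (abs_real_inner_le_norm _ _).trans
      (mul_le_mul_of_nonneg_left (hYn k) (norm_nonneg _))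
  have hanti : Antitone fun k => cubic A c ρ (gdIter A c ρ η x₀ k) := by
    refine antitone_nat_of_succ_le fun k => ?_
    have h1 := (sq_nonneg _).trans (h.descent k)
    have h2 := nonneg_of_mul_nonneg_right h1 (by positivity : 0 < 15 / 11 * η)
    linarith
  -- Only the perturbed objective decreases monotonically. Passing between the objectives at times
  -- `k` and `t` costs `2E < σbar ε`, which the slack in `(1 + σbar) ε` pays for.
  have hgap : ∀ k, k ≤ t → ε < cubic A b ρ (gdIter A c ρ η x₀ k) - cubic A b ρ s := by
    intro k hk
    have h1 := neg_le_of_abs_le (hG t)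
    have h2 := le_of_abs_le (hG k)
    have h3 : cubic A c ρ (gdIter A c ρ η x₀ t) ≤ cubic A c ρ (gdIter A c ρ η x₀ k) := hanti hk
    linarith
  set Λ := (β + 2 * ρ * ‖s‖) * ‖s‖ ^ 2 / ε with hΛ
  have hΛ2 : 2 ≤ Λ := by rw [hΛ, le_div_iff₀ hε]; linarith
  have hlogdef : tauConverge β ρ ε ‖s‖ = Real.log Λ := rfl
  rw [hlogdef] at ht hτ
  have hlog : Real.log 2 ≤ Real.log Λ := Real.log_le_log (by norm_num) hΛ2
  have hlog2 := Real.log_two_gt_d9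
  have hgt : ∀ n : ℕ, (∀ k ≤ n, ρ * ‖gdIter A c ρ η x₀ k‖ ≤ -lam i₀ - m / 3) →
      η * m * n ≤ 49 / 15 * (τ + Real.log Λ) := by
    intro n hn
    have h1 := h.growth_time he hμ hm0 hηm hc hK n hn
    have hlam : lam i₀ < 0 := by
      have := hn 0 (Nat.zero_le _)
      have := mul_nonneg hρ.le (norm_nonneg (gdIter A c ρ η x₀ 0))
      linarith
    linarith [hτ hlam]
  have hex : ∃ k, -lam i₀ - m / 3 < ρ * ‖gdIter A c ρ η x₀ k‖ ∧ k ≤ t := by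
    by_contra! hno
    have := hgt t fun k hk => by
      by_contra! h1
      exact absurd (hno k h1) (by omega)
    linarith
  classical
  have hex' : ∃ k, -lam i₀ - m / 3 < ρ * ‖gdIter A c ρ η x₀ k‖ := hex.imp fun _ h => h.1
  set t₀ := Nat.find hex' with ht₀
  have ht₀t : t₀ ≤ t := by
    obtain ⟨k, hk, hkt⟩ := hex
    exact (Nat.find_min' hex' hk).trans hkt
  -- The extra `4/15` pays for the step that leaves the growth region.
  have htime : η * m * t₀ ≤ 49 / 15 * (τ + Real.log Λ) + 4 / 15 := by
    rcases Nat.eq_zero_or_pos t₀ with h0 | h0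
    · rw [h0]; push_cast; linarith
    · obtain ⟨n, hn⟩ : ∃ n, t₀ = n + 1 := ⟨t₀ - 1, by omega⟩
      have := hgt n fun k hk => by
        have := Nat.find_min hex' (m := k) (by omega)
        linarith
      rw [hn]; push_cast; linarith
  have hgrow : ∀ k, t₀ ≤ k → -lam i₀ - m / 3 ≤ ρ * ‖gdIter A c ρ η x₀ k‖ := by
    intro k hk
    have h1 := Nat.find_spec hex'
    have h2 := mul_le_mul_of_nonneg_left (h.norm_monotone he hk) hρ.le
    exact h1.le.trans h2
  obtain ⟨n, rfl⟩ : ∃ n, t = t₀ + n := ⟨t - t₀, by omega⟩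
  have hdecay := h.gap_decay he hmin hs hμ hsR hNs hε (by linarith) hm (by linarith) n hgrow hgap
  have hexp : (1 - η * m / 3) ^ n ≤ Real.exp (-(n * (η * m / 3))) := by
    have h1 : 1 - η * m / 3 ≤ Real.exp (-(η * m / 3)) := by
      linarith [Real.add_one_le_exp (-(η * m / 3))]
    refine (pow_le_pow_left₀ (by linarith) h1 n).trans (le_of_eq ?_)
    rw [← Real.exp_nat_mul]; congr 1; ring
  have hΛε : (β + 2 * ρ * ‖s‖) * ‖s‖ ^ 2 = Λ * ε := by rw [hΛ]; field_simp
  have h1 : 1 < 4.12 * Λ * Real.exp (-(n * (η * m / 3))) := by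
    have h2 : ε < 4.12 * (Λ * ε) * (1 - η * m / 3) ^ n := by
      rw [← hΛε]; linarith
    have h3 : 1 * ε < (4.12 * Λ * (1 - η * m / 3) ^ n) * ε := by linarith
    have h4 := lt_of_mul_lt_mul_right h3 hε.le
    exact h4.trans_le (mul_le_mul_of_nonneg_left hexp (by positivity))
  have h2 := Real.log_lt_log one_pos h1
  have hΛ0 : Λ ≠ 0 := by positivity
  rw [Real.log_one, Real.log_mul (by positivity) (Real.exp_ne_zero _), Real.log_exp,
    Real.log_mul (by norm_num) hΛ0] at h2
  have h3 := log_four_point_one_two_le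
  push_cast at ht
  -- With `log 2 ≤ log Λ`, contraction lasts less than `3(1 + 9/4) log Λ` in units of `1/(ηm)`;
  -- adding `49/15 (τ + log Λ) + 4/15` stays below `6τ + 14 log Λ`.
  linarith

end Convergence

/-! ### Anti-concentration of a coordinate on the sphere. -/

section SphericalSlab

lemma hasDerivAt_div_sqrt_one_sub_sq (q : ℝ) {u : ℝ} (hu : u ^ 2 < 1) :
    HasDerivAt (fun u => q * (u / √(1 - u ^ 2))) (q * (√(1 - u ^ 2) ^ 3)⁻¹) u := by
  have h0 : 0 < 1 - u ^ 2 := by linarith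
  have hs : 0 < √(1 - u ^ 2) := Real.sqrt_pos.2 h0
  have h1 : HasDerivAt (fun u : ℝ => 1 - u ^ 2) (-(2 * u)) u := by
    simpa using (hasDerivAt_pow 2 u).const_sub 1
  have h2 := ((hasDerivAt_id u).div (h1.sqrt h0.ne') hs.ne').const_mul q
  refine h2.congr_deriv ?_
  have hsq : √(1 - u ^ 2) ^ 2 = 1 - u ^ 2 := Real.sq_sqrt h0.le
  simp only [id]
  have : (1 * √(1 - u ^ 2) - u * (-(2 * u) / (2 * √(1 - u ^ 2)))) / √(1 - u ^ 2) ^ 2 =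
      (√(1 - u ^ 2) ^ 2 + u ^ 2) / √(1 - u ^ 2) ^ 3 := by
    field_simp
    ring
  rw [this, hsq, sub_add_cancel, one_div]

/-- Change of variables `x = q u / √(1 - u²)` on a line at distance `q` from the origin. -/
lemma volume_line_slab_le {q : ℝ} (hq : 0 < q) (a b : ℝ) :
    volume {x : ℝ | x ^ 2 + q ^ 2 < 1 ∧ x / √(x ^ 2 + q ^ 2) ∈ Set.Ioo a b} ≤
      ∫⁻ u in Set.Ioo a b ∩ {u | q ^ 2 < 1 - u ^ 2},
        ENNReal.ofReal (q * (√(1 - u ^ 2) ^ 3)⁻¹) := by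
  have hmeas : MeasurableSet (Set.Ioo a b ∩ {u : ℝ | q ^ 2 < 1 - u ^ 2}) :=
    measurableSet_Ioo.inter (measurableSet_lt (by fun_prop) (by fun_prop))
  have h1 := addHaar_image_le_lintegral_abs_det_fderiv (volume : Measure ℝ) hmeas
    (f := fun u => q * (u / √(1 - u ^ 2)))
    (f' := fun u => ContinuousLinearMap.toSpanSingleton ℝ (q * (√(1 - u ^ 2) ^ 3)⁻¹))
    (fun u hu => ((hasDerivAt_div_sqrt_one_sub_sq q (by
      have := hu.2
      simp only [Set.mem_ofPred_eq] at this
      nlinarith [sq_pos_of_pos hq])).hasDerivWithinAt).hasFDerivWithinAt)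
  refine le_trans (measure_mono ?_) (h1.trans (le_of_eq ?_))
  · rintro x ⟨hx1, hx2⟩
    have hp : 0 < x ^ 2 + q ^ 2 := by positivity
    have hs : 0 < √(x ^ 2 + q ^ 2) := Real.sqrt_pos.2 hp
    have hsq : √(x ^ 2 + q ^ 2) ^ 2 = x ^ 2 + q ^ 2 := Real.sq_sqrt hp.le
    have h2 : 1 - (x / √(x ^ 2 + q ^ 2)) ^ 2 = (q / √(x ^ 2 + q ^ 2)) ^ 2 := by
      rw [div_pow, div_pow, hsq]; field_simp; ring
    refine ⟨x / √(x ^ 2 + q ^ 2), ⟨hx2, ?_⟩, ?_⟩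
    · simp only [Set.mem_ofPred_eq]
      rw [h2, div_pow, hsq, lt_div_iff₀ hp]
      nlinarith [sq_pos_of_pos hq]
    · simp only []
      rw [h2, Real.sqrt_sq (by positivity)]
      field_simp
  · refine setLIntegral_congr_fun hmeas fun u _ => ?_
    simp only [ContinuousLinearMap.det_toSpanSingleton]
    rw [abs_of_nonneg (by positivity)]

/-- Evaluates the inner integral that remains after Fubini in `volume_cone_slab_le`, by polar
coordinates. -/
lemma lintegral_norm_ball {n : ℕ} (hn : 0 < n) {R : ℝ} (hR : 0 < R) :
    ∫⁻ y in Metric.ball (0 : EuclideanSpace ℝ (Fin n)) R, ENNReal.ofReal ‖y‖ =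
      ENNReal.ofReal (n * volume.real (Metric.ball (0 : EuclideanSpace ℝ (Fin n)) 1) *
        (R ^ (n + 1) / (n + 1))) := by
  have : Nonempty (Fin n) := ⟨⟨0, hn⟩⟩
  have hint : IntegrableOn (fun y : EuclideanSpace ℝ (Fin n) => ‖y‖) (Metric.ball 0 R) := by
    refine IntegrableOn.mono_set ?_ Metric.ball_subset_closedBall
    exact continuous_norm.continuousOn.integrableOn_compact (isCompact_closedBall 0 R)
  rw [← ofReal_integral_eq_lintegral_ofReal hint (Filter.Eventually.of_forall fun y => norm_nonneg y)]
  congr 1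
  have h1 : ∫ y in Metric.ball (0 : EuclideanSpace ℝ (Fin n)) R, ‖y‖ =
      ∫ y : EuclideanSpace ℝ (Fin n), (Set.Iio R).indicator id ‖y‖ := by
    rw [← integral_indicator measurableSet_ball]
    congr 1
    ext y
    by_cases hy : ‖y‖ < R
    · rw [Set.indicator_of_mem (by simpa using hy), Set.indicator_of_mem (by simpa using hy), id]
    · rw [Set.indicator_of_notMem (by simpa using hy), Set.indicator_of_notMem (by simpa using hy)]
  rw [h1, integral_fun_norm_addHaar volume ((Set.Iio R).indicator id), finrank_euclideanSpace_fin]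
  have h2 : ∫ y in Set.Ioi (0 : ℝ), y ^ (n - 1) • (Set.Iio R).indicator id y =
      R ^ (n + 1) / (n + 1) := by
    have e1 : (fun y : ℝ => y ^ (n - 1) • (Set.Iio R).indicator id y) =
        (Set.Iio R).indicator fun y => y ^ n := by
      ext y
      by_cases hy : y ∈ Set.Iio R
      · rw [Set.indicator_of_mem hy, Set.indicator_of_mem hy, id, smul_eq_mul, ← pow_succ,
          Nat.sub_add_cancel hn]
      · rw [Set.indicator_of_notMem hy, Set.indicator_of_notMem hy, smul_zero]
    rw [e1, setIntegral_indicator measurableSet_Iio, Set.Ioi_inter_Iio,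
      ← integral_Ioc_eq_integral_Ioo, ← intervalIntegral.integral_of_le hR.le, integral_pow]
    simp
  rw [h2]
  simp only [nsmul_eq_mul, smul_eq_mul]
  ring

lemma measurableSet_cone_slab (n : ℕ) (a b : ℝ) :
    MeasurableSet {p : ℝ × EuclideanSpace ℝ (Fin n) | p.1 ^ 2 + ‖p.2‖ ^ 2 < 1 ∧
      p.1 / √(p.1 ^ 2 + ‖p.2‖ ^ 2) ∈ Set.Ioo a b} := by
  have h1 : MeasurableSet {p : ℝ × EuclideanSpace ℝ (Fin n) | p.1 ^ 2 + ‖p.2‖ ^ 2 < 1} :=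
    measurableSet_lt (by fun_prop) (by fun_prop)
  have h2 : Measurable fun p : ℝ × EuclideanSpace ℝ (Fin n) => p.1 / √(p.1 ^ 2 + ‖p.2‖ ^ 2) := by
    fun_prop
  exact h1.inter (h2 measurableSet_Ioo)

/-- Volume of the part of the unit ball of `ℝ × ℝⁿ` seen from the origin in directions whose first
coordinate lies in an interval. -/
lemma volume_cone_slab_le {n : ℕ} (hn : 2 ≤ n) (a b : ℝ) :
    volume {p : ℝ × EuclideanSpace ℝ (Fin n) | p.1 ^ 2 + ‖p.2‖ ^ 2 < 1 ∧
        p.1 / √(p.1 ^ 2 + ‖p.2‖ ^ 2) ∈ Set.Ioo a b} ≤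
      ENNReal.ofReal (n * volume.real (Metric.ball (0 : EuclideanSpace ℝ (Fin n)) 1) / (n + 1)) *
        ENNReal.ofReal (b - a) := by
  have hn0 : 0 < n := by omega
  have : Nonempty (Fin n) := ⟨⟨0, hn0⟩⟩
  set κ : ℝ := n * volume.real (Metric.ball (0 : EuclideanSpace ℝ (Fin n)) 1) / (n + 1) with hκ
  have hmeas := measurableSet_cone_slab n a b
  set g : EuclideanSpace ℝ (Fin n) → ℝ → ENNReal := fun y u =>
    {p : EuclideanSpace ℝ (Fin n) × ℝ | ‖p.1‖ ^ 2 < 1 - p.2 ^ 2}.indicator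
      (fun p => ENNReal.ofReal (‖p.1‖ * (√(1 - p.2 ^ 2) ^ 3)⁻¹)) (y, u) with hg
  have hgm : Measurable (Function.uncurry g) := by
    refine Measurable.indicator (by fun_prop) ?_
    exact measurableSet_lt (by fun_prop) (by fun_prop)
  rw [Measure.volume_eq_prod, Measure.prod_apply_symm hmeas]
  calc _ ≤ ∫⁻ y : EuclideanSpace ℝ (Fin n), ∫⁻ u in Set.Ioo a b, g y u := by
        refine lintegral_mono_ae ?_
        have hne : ∀ᵐ y : EuclideanSpace ℝ (Fin n), y ≠ 0 := by
          simp [ae_iff]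
        filter_upwards [hne] with y hy
        refine (volume_line_slab_le (norm_pos_iff.2 hy) a b).trans (le_of_eq ?_)
        rw [Set.inter_comm, ← setLIntegral_indicator
          (measurableSet_lt (by fun_prop) (by fun_prop))]
        rfl
    _ = ∫⁻ u in Set.Ioo a b, ∫⁻ y : EuclideanSpace ℝ (Fin n), g y u := by
        rw [lintegral_lintegral_swap hgm.aemeasurable]
    _ ≤ ∫⁻ _u in Set.Ioo a b, ENNReal.ofReal κ := by
        refine lintegral_mono fun u => ?_
        simp only []
        rcases le_or_gt 1 (u ^ 2) with hu | hu
        · have : ∀ y, g y u = 0 := fun y => by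
            simp only [hg]
            refine Set.indicator_of_notMem ?_ _
            simp only [Set.mem_ofPred_eq, not_lt]
            linarith [sq_nonneg ‖y‖]
          simp [this]
        set R := √(1 - u ^ 2) with hR
        have hR0 : 0 < R := Real.sqrt_pos.2 (by linarith)
        have hR1 : R ≤ 1 := Real.sqrt_le_one.2 (by linarith [sq_nonneg u])
        have hRsq : R ^ 2 = 1 - u ^ 2 := Real.sq_sqrt (by linarith)
        have h1 : ∀ y, g y u = (Metric.ball (0 : EuclideanSpace ℝ (Fin n)) R).indicator
            (fun y => ENNReal.ofReal ‖y‖ * ENNReal.ofReal ((R ^ 3)⁻¹)) y := by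
          intro y
          simp only [hg]
          by_cases hy : ‖y‖ < R
          · rw [Set.indicator_of_mem, Set.indicator_of_mem (by simpa using hy),
              ENNReal.ofReal_mul (norm_nonneg _)]
            simp only [Set.mem_ofPred_eq]
            rw [← hRsq]
            exact pow_lt_pow_left₀ hy (norm_nonneg _) two_ne_zero
          · rw [Set.indicator_of_notMem, Set.indicator_of_notMem (by simpa using hy)]
            simp only [Set.mem_ofPred_eq, not_lt]
            rw [← hRsq]
            exact pow_le_pow_left₀ hR0.le (not_lt.1 hy) 2
        simp only [h1]
        rw [lintegral_indicator measurableSet_ball, lintegral_mul_const _ (by fun_prop),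
          lintegral_norm_ball hn0 hR0, ← ENNReal.ofReal_mul (by positivity)]
        refine ENNReal.ofReal_le_ofReal ?_
        -- The fibre integral is `κ R^(n-2)`, at most `κ` because `n ≥ 2` and `R ≤ 1`. This is where
        -- `d > 2` matters: the coordinate density is bounded.
        obtain ⟨k, rfl⟩ : ∃ k, n = k + 2 := ⟨n - 2, by omega⟩
        have e1 : ((k + 2 : ℕ) : ℝ) *
            volume.real (Metric.ball (0 : EuclideanSpace ℝ (Fin (k + 2))) 1) *
            (R ^ (k + 2 + 1) / ((k + 2 : ℕ) + 1)) * (R ^ 3)⁻¹ = κ * R ^ k := by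
          rw [hκ, show k + 2 + 1 = k + 3 from rfl, pow_add]
          field_simp
        rw [e1]
        refine mul_le_of_le_one_right (by positivity) (pow_le_one₀ hR0.le hR1)
    _ = _ := by
        rw [lintegral_const, Measure.restrict_apply_univ, Real.volume_Ioo]

/-- Log-convexity of `Gamma` at the midpoint of `x` and `x + 1`. -/
lemma Gamma_add_half_le {x : ℝ} (hx : 0 < x) :
    Real.Gamma (x + 1 / 2) ≤ √x * Real.Gamma x := by
  have h := Real.Gamma_mul_add_mul_le_rpow_Gamma_mul_rpow_Gamma hx (by positivity : 0 < x + 1)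
    (by norm_num : (0 : ℝ) < 1 / 2) (by norm_num : (0 : ℝ) < 1 / 2) (by norm_num)
  rw [show (1 / 2 : ℝ) * x + 1 / 2 * (x + 1) = x + 1 / 2 by ring, Real.Gamma_add_one hx.ne',
    ← Real.sqrt_eq_rpow, ← Real.sqrt_eq_rpow, Real.sqrt_mul hx.le] at h
  have hG := Real.Gamma_pos_of_pos hx
  have := Real.mul_self_sqrt hG.le
  calc _ ≤ _ := h
    _ = √x * (√(Real.Gamma x) * √(Real.Gamma x)) := by ring
    _ = _ := by rw [this]

/-- Turns the density bound into `√d / 2` with `d = n + 1`. After the `Gamma` estimate, the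
remaining polynomial inequality needs only `π > 3`. -/
lemma volume_real_ball_ratio (n : ℕ) (hn : 0 < n) :
    n * volume.real (Metric.ball (0 : EuclideanSpace ℝ (Fin n)) 1) / (n + 1) ≤
      √((n : ℝ) + 1) / 2 * volume.real (Metric.ball (0 : EuclideanSpace ℝ (Fin (n + 1))) 1) := by
  have : Nonempty (Fin n) := ⟨⟨0, hn⟩⟩
  have hball : ∀ k : ℕ, [Nonempty (Fin k)] →
      volume.real (Metric.ball (0 : EuclideanSpace ℝ (Fin k)) 1) =
        √Real.pi ^ k / Real.Gamma ((k : ℝ) / 2 + 1) := by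
    intro k hk
    have hG := Real.Gamma_pos_of_pos (by positivity : 0 < (k : ℝ) / 2 + 1)
    rw [measureReal_def, EuclideanSpace.volume_ball, Fintype.card_fin, ENNReal.ofReal_one, one_pow,
      one_mul, ENNReal.toReal_ofReal (by positivity)]
  rw [hball, hball]
  have hG := Real.Gamma_pos_of_pos (by positivity : 0 < (n : ℝ) / 2 + 1)
  have hG' := Real.Gamma_pos_of_pos (by positivity : 0 < ((n + 1 : ℕ) : ℝ) / 2 + 1)
  have h1 : Real.Gamma (((n + 1 : ℕ) : ℝ) / 2 + 1) ≤
      √((n : ℝ) / 2 + 1) * Real.Gamma ((n : ℝ) / 2 + 1) := by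
    have := Gamma_add_half_le (by positivity : 0 < (n : ℝ) / 2 + 1)
    convert this using 2
    push_cast; ring
  have hpi : 0 < √Real.pi := Real.sqrt_pos.2 Real.pi_pos
  have h2 : (n : ℝ) * √((n : ℝ) / 2 + 1) ≤ (n + 1) * (√((n : ℝ) + 1) / 2 * √Real.pi) := by
    refine abs_le_of_sq_le_sq' ?_ (by positivity) |>.2
    have e1 : ((n : ℝ) * √((n : ℝ) / 2 + 1)) ^ 2 = n ^ 2 * (n / 2 + 1) := by
      rw [mul_pow, Real.sq_sqrt (by positivity)]
    have e2 : (((n : ℝ) + 1) * (√((n : ℝ) + 1) / 2 * √Real.pi)) ^ 2 =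
        (n + 1) ^ 3 / 4 * Real.pi := by
      rw [mul_pow, mul_pow, div_pow, Real.sq_sqrt (by positivity), Real.sq_sqrt Real.pi_pos.le]
      ring
    rw [e1, e2]
    have h3 : ((n : ℝ) + 1) ^ 3 / 4 * 3 ≤ (n + 1) ^ 3 / 4 * Real.pi :=
      mul_le_mul_of_nonneg_left Real.pi_gt_three.le (by positivity)
    have : (0 : ℝ) ≤ n := Nat.cast_nonneg n
    have : (0 : ℝ) ≤ (n : ℝ) ^ 3 := by positivity
    have : (0 : ℝ) ≤ (n : ℝ) ^ 2 := by positivity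
    linarith
  have h3 : (n : ℝ) * Real.Gamma (((n + 1 : ℕ) : ℝ) / 2 + 1) ≤
      (n + 1) * (√((n : ℝ) + 1) / 2 * √Real.pi) * Real.Gamma ((n : ℝ) / 2 + 1) := by
    have h4 := mul_le_mul_of_nonneg_left h1 (Nat.cast_nonneg (α := ℝ) n)
    have h5 := mul_le_mul_of_nonneg_right h2 hG.le
    linarith
  rw [div_le_iff₀ (by positivity), ← mul_div_assoc, ← mul_div_assoc, div_mul_eq_mul_div,
    div_le_div_iff₀ hG hG', pow_succ]
  have := mul_le_mul_of_nonneg_left h3 (by positivity : 0 ≤ √Real.pi ^ n)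
  linarith

/-- An isometry splitting off the coordinate along a unit vector. -/
lemma exists_isometry_fst_eq_inner {n : ℕ} {v : EuclideanSpace ℝ (Fin (n + 1))} (hv : ‖v‖ = 1) :
    ∃ φ : EuclideanSpace ℝ (Fin (n + 1)) ≃ₗᵢ[ℝ] WithLp 2 (ℝ × EuclideanSpace ℝ (Fin n)),
      ∀ x, (φ x).fst = inner ℝ v x := by
  have hfin : Module.finrank ℝ (WithLp 2 (ℝ × EuclideanSpace ℝ (Fin n))) = n + 1 := by
    rw [(WithLp.linearEquiv 2 ℝ (ℝ × EuclideanSpace ℝ (Fin n))).finrank_eq]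
    simp [add_comm]
  let ψ := ((stdOrthonormalBasis ℝ (WithLp 2 (ℝ × EuclideanSpace ℝ (Fin n)))).reindex
    (finCongr hfin)).repr.symm
  let w : WithLp 2 (ℝ × EuclideanSpace ℝ (Fin n)) := WithLp.toLp 2 (1, 0)
  have hw : ‖w‖ = 1 := by
    have : ‖w‖ ^ 2 = 1 := by rw [WithLp.prod_norm_sq_eq_of_L2]; simp [w]
    exact (pow_eq_one_iff_of_nonneg (norm_nonneg w) two_ne_zero).1 this
  have hvw : ‖ψ v‖ = ‖w‖ := by rw [ψ.norm_map, hv, hw]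
  -- The reflection in the hyperplane orthogonal to `ψ v - w` carries `ψ v` to `w`.
  refine ⟨ψ.trans ((ℝ ∙ (ψ v - w))ᗮ.reflection), fun x => ?_⟩
  have h1 : (ψ.trans ((ℝ ∙ (ψ v - w))ᗮ.reflection)) v = w := Submodule.reflection_sub hvw
  rw [← (ψ.trans ((ℝ ∙ (ψ v - w))ᗮ.reflection)).inner_map_map v x, h1, WithLp.prod_inner_apply]
  simp [w]

open scoped Pointwise in
/-- Anti-concentration of a coordinate of the uniform distribution on the sphere. -/
lemma uniformSphere_slab_le {d : ℕ} (hd : 2 < d) {v : EuclideanSpace ℝ (Fin d)} (hv : ‖v‖ = 1)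
    (a b : ℝ) :
    uniformSphere d {u | inner ℝ v (u : EuclideanSpace ℝ (Fin d)) ∈ Set.Ioo a b} ≤
      ENNReal.ofReal (√(d : ℝ) / 2 * (b - a)) := by
  obtain ⟨n, rfl⟩ : ∃ n, d = n + 1 := ⟨d - 1, by omega⟩
  have hn : 2 ≤ n := by omega
  obtain ⟨φ, hφ⟩ := exists_isometry_fst_eq_inner hv
  set S : Set (Metric.sphere (0 : EuclideanSpace ℝ (Fin (n + 1))) 1) :=
    {u | inner ℝ v (u : EuclideanSpace ℝ (Fin (n + 1))) ∈ Set.Ioo a b} with hS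
  have hSm : MeasurableSet S :=
    (by fun_prop : Measurable fun u : Metric.sphere (0 : EuclideanSpace ℝ (Fin (n + 1))) 1 =>
      inner ℝ v (u : EuclideanSpace ℝ (Fin (n + 1)))) measurableSet_Ioo
  set C : Set (ℝ × EuclideanSpace ℝ (Fin n)) := {p | p.1 ^ 2 + ‖p.2‖ ^ 2 < 1 ∧
        p.1 / √(p.1 ^ 2 + ‖p.2‖ ^ 2) ∈ Set.Ioo a b} with hC
  have hCm : MeasurableSet C := measurableSet_cone_slab n a b
  have hmp := (WithLp.volume_preserving_ofLp ℝ (EuclideanSpace ℝ (Fin n))).comp φ.measurePreserving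
  have hcone : volume (Set.Ioo (0 : ℝ) 1 • (Subtype.val '' S)) ≤ volume C := by
    rw [← hmp.measure_preimage hCm.nullMeasurableSet]
    refine measure_mono ?_
    rintro _ ⟨r, hr, _, ⟨u, hu, rfl⟩, rfl⟩
    have hnu : ‖(u : EuclideanSpace ℝ (Fin (n + 1)))‖ = 1 := by simp
    have hnorm : (φ (r • (u : EuclideanSpace ℝ (Fin (n + 1))))).fst ^ 2 +
        ‖(φ (r • (u : EuclideanSpace ℝ (Fin (n + 1))))).snd‖ ^ 2 = r ^ 2 := by
      have h1 := WithLp.prod_norm_sq_eq_of_L2 (φ (r • (u : EuclideanSpace ℝ (Fin (n + 1)))))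
      rw [φ.norm_map, norm_smul, hnu, mul_one, Real.norm_eq_abs, Real.norm_eq_abs, sq_abs,
        sq_abs] at h1
      exact h1.symm
    refine Set.mem_preimage.2 ⟨?_, ?_⟩
    · refine lt_of_eq_of_lt hnorm ?_
      exact pow_lt_one₀ hr.1.le hr.2 two_ne_zero
    · have h2 : (φ (r • (u : EuclideanSpace ℝ (Fin (n + 1))))).fst /
          √((φ (r • (u : EuclideanSpace ℝ (Fin (n + 1))))).fst ^ 2 +
          ‖(φ (r • (u : EuclideanSpace ℝ (Fin (n + 1))))).snd‖ ^ 2) =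
          inner ℝ v (u : EuclideanSpace ℝ (Fin (n + 1))) := by
        rw [hnorm, Real.sqrt_sq hr.1.le, hφ, real_inner_smul_right,
          mul_div_cancel_left₀ _ hr.1.ne']
      have h3 : inner ℝ v (u : EuclideanSpace ℝ (Fin (n + 1))) ∈ Set.Ioo a b := hu
      rw [← h2] at h3
      exact h3
  have hball0 : volume (Metric.ball (0 : EuclideanSpace ℝ (Fin (n + 1))) 1) ≠ 0 :=
    (Metric.measure_ball_pos volume _ one_pos).ne'
  have hballT : volume (Metric.ball (0 : EuclideanSpace ℝ (Fin (n + 1))) 1) ≠ ⊤ :=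
    measure_ball_lt_top.ne
  have hd0 : ((n + 1 : ℕ) : ENNReal) ≠ 0 := by simp
  have hdT : ((n + 1 : ℕ) : ENNReal) ≠ ⊤ := ENNReal.natCast_ne_top _
  rw [uniformSphere, Measure.smul_apply, smul_eq_mul, Measure.toSphere_apply_univ,
    Measure.toSphere_apply' _ hSm, finrank_euclideanSpace_fin,
    ENNReal.mul_inv (Or.inl hd0) (Or.inl hdT)]
  calc _ = (volume (Metric.ball (0 : EuclideanSpace ℝ (Fin (n + 1))) 1))⁻¹ *
        volume (Set.Ioo (0 : ℝ) 1 • (Subtype.val '' S)) := by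
        rw [mul_mul_mul_comm, ENNReal.inv_mul_cancel hd0 hdT, one_mul]
    _ ≤ (volume (Metric.ball (0 : EuclideanSpace ℝ (Fin (n + 1))) 1))⁻¹ *
        (ENNReal.ofReal (√((n : ℝ) + 1) / 2 *
          volume.real (Metric.ball (0 : EuclideanSpace ℝ (Fin (n + 1))) 1)) *
          ENNReal.ofReal (b - a)) := by
        gcongr
        refine (hcone.trans (volume_cone_slab_le hn a b)).trans ?_
        gcongr
        exact volume_real_ball_ratio n (by omega)
    _ = _ := by
        rw [ENNReal.ofReal_mul (by positivity), measureReal_def, ENNReal.ofReal_toReal hballT,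
          mul_comm (ENNReal.ofReal _) (volume _), mul_assoc, ← mul_assoc,
          ENNReal.inv_mul_cancel hball0 hballT, one_mul, ← ENNReal.ofReal_mul (by positivity)]
        push_cast
        rfl

end SphericalSlab

/-! ### Either step-size rule gives a bounded run. -/

section Radius

variable {d : ℕ} {A : Matrix (Fin d) (Fin d) ℝ} {b c s x₀ : EuclideanSpace ℝ (Fin d)}
  {ρ β η : ℝ}

lemma upperRadius_sq (hρ : 0 < ρ) (b : EuclideanSpace ℝ (Fin d)) :
    ρ * upperRadius β ρ b ^ 2 = β * upperRadius β ρ b + ‖b‖ := by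
  have h1 : √((β / (2 * ρ)) ^ 2 + ‖b‖ / ρ) ^ 2 = (β / (2 * ρ)) ^ 2 + ‖b‖ / ρ :=
    Real.sq_sqrt (by positivity)
  have h2 : β = 2 * ρ * (β / (2 * ρ)) := by field_simp
  have h3 : ‖b‖ = ρ * (‖b‖ / ρ) := by field_simp
  rw [upperRadius]
  set p := β / (2 * ρ)
  set n := ‖b‖ / ρ
  set q := √(p ^ 2 + n)
  rw [h2, h3]
  linear_combination ρ * h1

lemma le_upperRadius {r : ℝ} (hρ : 0 < ρ) (b : EuclideanSpace ℝ (Fin d))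
    (hr : ρ * r ^ 2 ≤ β * r + ‖b‖) : r ≤ upperRadius β ρ b := by
  have h2 : β = 2 * ρ * (β / (2 * ρ)) := by field_simp
  have h3 : ‖b‖ = ρ * (‖b‖ / ρ) := by field_simp
  rw [upperRadius]
  set p := β / (2 * ρ)
  set n := ‖b‖ / ρ
  rw [h2, h3] at hr
  have h4 : r ^ 2 ≤ 2 * p * r + n := le_of_mul_le_mul_left (by linarith) hρ
  have h5 := Real.le_sqrt_of_sq_le (x := r - p) (y := p ^ 2 + n) (by linarith)
  linarith

/-- A minimizer obeys the norm bound, and either step-size rule yields a bounded run. -/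
lemma exists_boundedRun (hA : A.IsSymm) (hρ : 0 < ρ) (hβ : ‖opOf A‖ ≤ β)
    (hs : opOf A s + b + (ρ * ‖s‖) • s = 0) (hs0 : s ≠ 0)
    (hcb : ‖c - b‖ * 24 ≤ ρ * ‖s‖ ^ 2) (hη : StepSize β ρ b η ∨ StepSize β ρ c η)
    (hx : Initialization A ρ c x₀) : ∃ R, BoundedRun A c ρ β η R x₀ ∧ ‖s‖ ≤ R := by
  have hβ0 : 0 ≤ β := (norm_nonneg _).trans hβ
  have hr0 : 0 < ‖s‖ := norm_pos_iff.2 hs0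
  have hbc : ‖b‖ ≤ ‖c‖ + ‖c - b‖ := by
    have := norm_sub_le c (c - b)
    rwa [sub_sub_cancel] at this
  have hcb2 : ‖c‖ ≤ ‖b‖ + ‖c - b‖ := by
    have := norm_add_le b (c - b)
    rwa [add_sub_cancel] at this
  have hsb : ρ * ‖s‖ ^ 2 ≤ β * ‖s‖ + ‖b‖ := by
    have h1 : (ρ * ‖s‖) • s = -(opOf A s + b) := by
      rw [eq_neg_iff_add_eq_zero, add_comm]; exact hs
    have h2 : ρ * ‖s‖ * ‖s‖ = ‖opOf A s + b‖ := by
      rw [← norm_neg (opOf A s + b), ← h1, norm_smul, Real.norm_of_nonneg (by positivity)]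
    have h3 := norm_add_le (opOf A s) b
    have h4 := norm_opOf_le hβ s
    linarith
  -- Enlarging the radius by `24/23` absorbs the change of linear term, whichever of the two defines
  -- the step size. The cost is `24/23 · 1/4 ≤ 4/15`.
  have hstep : ∀ {n : EuclideanSpace ℝ (Fin d)}, StepSize β ρ n η → 0 < upperRadius β ρ n →
      η * (β + ρ * (24 / 23 * upperRadius β ρ n)) ≤ 4 / 15 := by
    rintro n ⟨h0, h1⟩ hU
    have h2 : 0 < β + ρ * upperRadius β ρ n := by positivity
    rw [le_div_iff₀ (by positivity)] at h1
    have := mul_nonneg h0.le hβ0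
    linarith
  rcases hη with hη | hη
  · set U := upperRadius β ρ b with hU
    have hrU : ‖s‖ ≤ U := le_upperRadius hρ b hsb
    have hU0 : 0 < U := hr0.trans_le hrU
    have hUq : ρ * U ^ 2 = β * U + ‖b‖ := upperRadius_sq hρ b
    refine ⟨24 / 23 * U, ⟨hA, hρ, hη.1, hβ, by positivity, ?_, hstep hη hU0, hx⟩, by linarith⟩
    have h1 : ρ * ‖s‖ ^ 2 ≤ ρ * U ^ 2 := by gcongr
    have h2 : 0 ≤ β * U := by positivity
    have h3 := norm_nonneg b
    nlinarith
  · set U := upperRadius β ρ c with hU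
    have hrU : 23 / 24 * ‖s‖ ≤ U := by
      refine le_upperRadius hρ c ?_
      have := mul_pos hρ (pow_pos hr0 2)
      have := norm_nonneg c
      linarith
    have hU0 : 0 < U := lt_of_lt_of_le (by positivity) hrU
    have hUq : ρ * U ^ 2 = β * U + ‖c‖ := upperRadius_sq hρ c
    refine ⟨24 / 23 * U, ⟨hA, hρ, hη.1, hβ, by positivity, ?_, hstep hη hU0, hx⟩, by linarith⟩
    have h2 : 0 ≤ β * U := by positivity
    have h3 := norm_nonneg c
    nlinarith

end Radius

/-! ### Perturbation size and iteration bound. -/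

section Parameters

lemma pertSize_pos {β ρ ε σbar n : ℝ} (hβ : 0 ≤ β) (hρ : 0 < ρ) (hε : 0 < ε) (hσ : 0 < σbar)
    (hn : 0 < n) : 0 < pertSize β ρ ε σbar n := by
  rw [pertSize]; positivity

lemma pertSize_mul {β ρ ε σbar n : ℝ} (hβ : 0 ≤ β) (hρ : 0 < ρ) (hn : 0 < n) :
    pertSize β ρ ε σbar n * (12 * (β + 2 * ρ * n)) = ρ * ε * σbar := by
  have : 0 < β + 2 * ρ * n := by positivity
  rw [pertSize]; field_simp

/-- Replaces the minimum by a single rate `m = max {μ, 1/q}`, which also covers `μ = 0`. -/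
lemma exists_minInv_eq {μ q : ℝ} (hμ : 0 ≤ μ) (hq : 0 < q) :
    ∃ m : ℝ, 0 < m ∧ minInv μ q = 1 / m ∧ (m = μ ∨ μ ≤ m ∧ m * q = 1) := by
  have hq' : 0 < 1 / q := by positivity
  have e : 1 / q * q = 1 := by field_simp
  rcases hμ.eq_or_lt with h0 | h0
  · exact ⟨1 / q, hq', by rw [minInv, if_pos h0.symm, one_div_one_div], Or.inr ⟨by linarith, e⟩⟩
  rw [minInv, if_neg h0.ne']
  rcases le_total (1 / μ) q with h | h
  · exact ⟨μ, h0, min_eq_left h, Or.inl rfl⟩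
  · refine ⟨1 / q, hq', by rw [min_eq_right h, one_div_one_div], Or.inr ⟨?_, e⟩⟩
    have := one_div_le_one_div_of_le hq h
    rwa [one_div_one_div] at this

/-- The factor `1 + σbar` in the bound is simply discarded. -/
lemma le_of_iterBound_le {d : ℕ} {lam β ρ ε δ σbar η n m : ℝ} {t : ℝ} (hσ : 0 < σbar)
    (hη : 0 < η) (hm : 0 < m) (hg : 0 ≤ tauGrow d lam δ σbar) (hc : 0 ≤ tauConverge β ρ ε n)
    (hmin : minInv (lam + ρ * n) (10 * n ^ 2 / ε) = 1 / m)
    (ht : iterBound d lam β ρ ε δ σbar η n ≤ t) :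
    6 * tauGrow d lam δ σbar + 14 * tauConverge β ρ ε n ≤ η * m * t := by
  rw [iterBound, hmin] at ht
  have hS : 0 ≤ 6 * tauGrow d lam δ σbar + 14 * tauConverge β ρ ε n := by linarith
  set S := 6 * tauGrow d lam δ σbar + 14 * tauConverge β ρ ε n
  have h1 : S / ((1 + σbar)⁻¹ * η) * (1 / m) = S * (1 + σbar) / (η * m) := by
    field_simp
  rw [h1, div_le_iff₀ (by positivity)] at ht
  have := mul_nonneg hS hσ.le
  linarith

lemma tauGrow_nonneg {d : ℕ} {lam δ σbar : ℝ} (hδ : 0 < δ) (hσ : 0 < σbar) :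
    0 ≤ tauGrow d lam δ σbar := by
  refine Real.log_nonneg ?_
  have : 0 ≤ 3 * (if lam < 0 then (1 : ℝ) else 0) * √(d : ℝ) / (σbar * δ) := by
    split_ifs <;> positivity
  linarith

lemma two_le_of_eps_le {β ρ ε n : ℝ} (hε : 0 < ε) (hε' : ε ≤ (β / 2 + ρ * n) * n ^ 2) :
    2 ≤ (β + 2 * ρ * n) * n ^ 2 / ε := by
  rw [le_div_iff₀ hε]; linarith

/-- `1 + XΛ ≤ (1 + X)Λ` for `Λ ≥ 1`: the growth phase is charged partly to `tauConverge`. -/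
lemma log_one_add_mul_le {d : ℕ} {lam β ρ ε δ σbar n : ℝ} (hδ : 0 < δ) (hσ : 0 < σbar)
    (hlam : lam < 0) (hΛ : 2 ≤ (β + 2 * ρ * n) * n ^ 2 / ε) :
    Real.log (1 + 3 * √(d : ℝ) / (σbar * δ) * ((β + 2 * ρ * n) * n ^ 2 / ε)) ≤
      tauGrow d lam δ σbar + tauConverge β ρ ε n := by
  rw [tauGrow, tauConverge, if_pos hlam, mul_one]
  have hX : 0 ≤ 3 * √(d : ℝ) / (σbar * δ) := by positivity
  set X := 3 * √(d : ℝ) / (σbar * δ)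
  set Λ := (β + 2 * ρ * n) * n ^ 2 / ε
  rw [← Real.log_mul (by positivity) (by positivity)]
  exact Real.log_le_log (by positivity) (by linarith)

end Parameters

/-! ### The component of the perturbed linear term along one eigenvector. -/

section Probability

/-- The uniform perturbation moves a fixed coordinate away from zero with high probability. -/
lemma measure_abs_inner_lt_le {d : ℕ} (hd : 2 < d) {Ω : Type*} [MeasurableSpace Ω]
    {P : Measure Ω} {u : Ω → Metric.sphere (0 : EuclideanSpace ℝ (Fin d)) 1}
    (hu : HasLaw u (uniformSphere d) P) {v : EuclideanSpace ℝ (Fin d)} (hv : ‖v‖ = 1)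
    (b : EuclideanSpace ℝ (Fin d)) {σ : ℝ} (hσ : 0 < σ) (δ : ℝ) :
    P {ω | |inner ℝ v (b + σ • (u ω : EuclideanSpace ℝ (Fin d)))| < σ * δ / √(d : ℝ)} ≤
      ENNReal.ofReal δ := by
  set k := inner ℝ v b
  set h := δ / √(d : ℝ) with hh
  have hd0 : 0 < √(d : ℝ) := Real.sqrt_pos.2 (by positivity)
  have heq : {ω | |inner ℝ v (b + σ • (u ω : EuclideanSpace ℝ (Fin d)))| < σ * δ / √(d : ℝ)} =
      {ω | inner ℝ v (u ω : EuclideanSpace ℝ (Fin d)) ∈ Set.Ioo (-h - k / σ) (h - k / σ)} := by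
    ext ω
    simp only [Set.mem_ofPred_eq, Set.mem_Ioo]
    rw [inner_add_right, real_inner_smul_right, abs_lt, mul_div_assoc, ← hh]
    have e : inner ℝ v b = σ * (k / σ) := by field_simp; rfl
    rw [e]
    constructor
    · rintro ⟨h1, h2⟩
      exact ⟨lt_of_mul_lt_mul_left (by linarith) hσ.le, lt_of_mul_lt_mul_left (by linarith) hσ.le⟩
    · rintro ⟨h1, h2⟩
      have h3 := mul_lt_mul_of_pos_left h1 hσ
      have h4 := mul_lt_mul_of_pos_left h2 hσ
      exact ⟨by linarith, by linarith⟩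
  have hm : MeasurableSet {x : Metric.sphere (0 : EuclideanSpace ℝ (Fin d)) 1 |
      inner ℝ v (x : EuclideanSpace ℝ (Fin d)) ∈ Set.Ioo (-h - k / σ) (h - k / σ)} :=
    (by fun_prop : Measurable fun x : Metric.sphere (0 : EuclideanSpace ℝ (Fin d)) 1 =>
      inner ℝ v (x : EuclideanSpace ℝ (Fin d))) measurableSet_Ioo
  rw [heq, hu.measure_eq hm]
  refine (uniformSphere_slab_le hd hv _ _).trans (ENNReal.ofReal_le_ofReal (le_of_eq ?_))
  rw [hh]
  field_simp
  ring

end Probability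

end CubicGD

theorem corollary5p1
    {d : ℕ} (hd : 2 < d)
    (A : Matrix (Fin d) (Fin d) ℝ) (hA : A.IsSymm)
    (b : EuclideanSpace ℝ (Fin d))
    (ρ : ℝ) (hρ : 0 < ρ)
    (β : ℝ) (hβ : ‖CubicGD.opOf A‖ ≤ β)
    (s : EuclideanSpace ℝ (Fin d))
    (hs : ∀ y, CubicGD.cubic A b ρ s ≤ CubicGD.cubic A b ρ y)
    (ε : ℝ) (hε : 0 < ε) (hε' : ε ≤ (β / 2 + ρ * ‖s‖) * ‖s‖ ^ 2)
    (δ : ℝ) (hδ : 0 < δ)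
    (σbar : ℝ) (hσ : 0 < σbar) (hσ' : σbar ≤ 1)
    {Ω : Type*} [MeasurableSpace Ω] (P : Measure Ω) [IsProbabilityMeasure P]
    (u : Ω → Metric.sphere (0 : EuclideanSpace ℝ (Fin d)) 1)
    (hu : HasLaw u (CubicGD.uniformSphere d) P)
    (btilde : Ω → EuclideanSpace ℝ (Fin d))
    (hb : ∀ ω, btilde ω =
      b + CubicGD.pertSize β ρ ε σbar ‖s‖ • (u ω : EuclideanSpace ℝ (Fin d))) :
    ∃ G : Set Ω, MeasurableSet G ∧ 1 - δ ≤ P.real G ∧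
      ∀ ω ∈ G, ∀ η : ℝ,
        (CubicGD.StepSize β ρ b η ∨ CubicGD.StepSize β ρ (btilde ω) η) →
        ∀ x₀ : EuclideanSpace ℝ (Fin d), CubicGD.Initialization A ρ (btilde ω) x₀ →
        ∀ t : ℕ, CubicGD.iterBound d (CubicGD.lamMin A) β ρ ε δ σbar η ‖s‖ ≤ (t : ℝ) →
          CubicGD.cubic A b ρ (CubicGD.gdIter A (btilde ω) ρ η x₀ t) ≤
            CubicGD.cubic A b ρ s + (1 + σbar) * ε := by
  have hβ0 : 0 ≤ β := (norm_nonneg _).trans hβ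
  have hs0 : s ≠ 0 := by
    rintro rfl
    simp at hε'
    linarith
  have hr0 : 0 < ‖s‖ := norm_pos_iff.2 hs0
  have hstat := CubicGD.stationary_of_minimizer hA hs
  obtain ⟨e, lam, i₀, he, hlam, hmin⟩ := CubicGD.exists_eigenbasis (by omega) hA
  have hμ : 0 ≤ lam i₀ + ρ * ‖s‖ := by
    have h := CubicGD.curvature_nonneg_of_minimizer hA hs hs0 (e i₀)
    rw [he, real_inner_smul_right, real_inner_self_eq_norm_sq, e.norm_eq_one] at h
    linarith
  set σ := CubicGD.pertSize β ρ ε σbar ‖s‖ with hσdef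
  have hσ0 : 0 < σ := CubicGD.pertSize_pos hβ0 hρ hε hσ hr0
  have hσmul : σ * (12 * (β + 2 * ρ * ‖s‖)) = ρ * ε * σbar := CubicGD.pertSize_mul hβ0 hρ hr0
  have hd0 : 0 < √(d : ℝ) := Real.sqrt_pos.2 (by positivity)
  set B : Set Ω := {ω | |inner ℝ (e i₀) (btilde ω)| < σ * δ / √(d : ℝ)} with hB
  have hPB : P B ≤ ENNReal.ofReal δ := by
    have := CubicGD.measure_abs_inner_lt_le hd hu (e.norm_eq_one i₀) b hσ0 δ
    simp only [← hb] at this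
    exact this
  -- `u` is only almost everywhere measurable, so `B` need not be measurable; its measurable hull
  -- has the same measure.
  refine ⟨(toMeasurable P B)ᶜ, (measurableSet_toMeasurable P B).compl, ?_, ?_⟩
  · rw [probReal_compl_eq_one_sub (measurableSet_toMeasurable P B), measureReal_def,
      measure_toMeasurable]
    have := ENNReal.toReal_le_of_le_ofReal hδ.le hPB
    linarith
  intro ω hω η hη x₀ hx₀ t ht
  have hc : σ * δ / √(d : ℝ) ≤ |inner ℝ (e i₀) (btilde ω)| := by
    by_contra! h
    exact hω (subset_toMeasurable P B h)
  have hcpos : 0 < |inner ℝ (e i₀) (btilde ω)| := lt_of_lt_of_le (by positivity) hc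
  have hcb : ‖btilde ω - b‖ = σ := by
    rw [hb, add_sub_cancel_left, norm_smul, Real.norm_of_nonneg hσ0.le]
    simp
  have hρε : 0 < ρ * ε := by positivity
  have hcb1 : ‖btilde ω - b‖ * (24 * ‖s‖) ≤ ε * σbar := by
    rw [hcb]
    refine le_of_mul_le_mul_left ?_ hρ
    have : 0 ≤ σ * β := by positivity
    linarith
  have hcb2 : ‖btilde ω - b‖ * 24 ≤ ρ * ‖s‖ ^ 2 := by
    rw [hcb]
    have hL : 0 < β + 2 * ρ * ‖s‖ := by positivity
    refine le_of_mul_le_mul_right ?_ hL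
    have h1 : ρ * ε * σbar ≤ ρ * ε := mul_le_of_le_one_right hρε.le hσ'
    have h2 := mul_le_mul_of_nonneg_left hε' hρ.le
    linarith
  obtain ⟨R, hrun, hsR⟩ := CubicGD.exists_boundedRun hA hρ hβ hstat hs0 hcb2 hη hx₀
  obtain ⟨m, hm0, hmeq, hm⟩ := CubicGD.exists_minInv_eq hμ
    (by positivity : 0 < 10 * ‖s‖ ^ 2 / ε)
  have hΛ := CubicGD.two_le_of_eps_le hε hε'
  rw [hlam] at ht
  have hgrow0 := CubicGD.tauGrow_nonneg (d := d) (lam := lam i₀) hδ hσ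
  have htime := CubicGD.le_of_iterBound_le hσ hrun.eta_pos hm0 hgrow0
    (Real.log_nonneg (by linarith)) hmeq ht
  refine hrun.cubic_le he hmin hstat hμ hs0 hsR hε hε' hσ hσ' hcb1 hcb2 hm0 ?_
    (K := 3 * √(d : ℝ) / (σbar * δ) * ((β + 2 * ρ * ‖s‖) * ‖s‖ ^ 2 / ε)) hcpos ?_ hgrow0
    (fun hneg => CubicGD.log_one_add_mul_le hδ hσ hneg hΛ) htime
  · refine hm.imp_right fun ⟨h1, h2⟩ => ⟨h1, le_of_eq ?_⟩
    field_simp at h2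
    linarith
  · have hK0 : 0 ≤ 3 * √(d : ℝ) / (σbar * δ) * ((β + 2 * ρ * ‖s‖) * ‖s‖ ^ 2 / ε) := by positivity
    refine le_trans (le_of_eq ?_) (mul_le_mul_of_nonneg_right hc hK0)
    -- `K` is chosen so that `√d` and `δ` cancel; the definition of `σ` then gives exactly
    -- `ρ‖s‖²/4`.
    have h1 : σ * δ / √(d : ℝ) *
        (3 * √(d : ℝ) / (σbar * δ) * ((β + 2 * ρ * ‖s‖) * ‖s‖ ^ 2 / ε)) =
        σ * (12 * (β + 2 * ρ * ‖s‖)) * ‖s‖ ^ 2 / (4 * (σbar * ε)) := by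
      field_simp
      ring
    rw [h1, hσmul]
    field_simp
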